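/- Let $S^3\subset\mathbb R^4$ and $S^2\subset\mathbb R^3$ be the round unit spheres, let $B^4$ be the open unit ball of $\mathbb R^4$ with closure $\overline{B^4}$ and boundary $\partial B^4=S^3$. Let $W^{1,2}(S^3,S^2)$ be the set of (a.e. classes of) maps $u\in L^2(S^3,\mathbb R^3)$ with weak differential $du\in L^2$ and $|u|=1$ a.e., with the topology of the $W^{1,2}$-norm, and let $$E(u)=\int_{S^3}|du|^2\,dvol_{S^3}$$ be the Dirichlet energy ($|du|$ is the Hilbert–Schmidt norm). Let $\mathrm{Sweep}^1_1(S^3,S^2)$ be the set of all continuous families $u:\overline{B^4}\to W^{1,2}(S^3,S^2)$, $a\mapsto u_a$, such that (i) $u$ belongs to $C^0(B^4\times S^3,S^2)$: there is a continuous map $v:B^4\times S^3\to S^2$ with $u_a=v(a,\cdot)$ a.e. on $S^3$ for every $a\in B^4$; (ii) for every $a\in\partial B^4$ the map $u_a$ is a.e. equal to a constant $c(a)\in S^2$, and the resulting continuous map $c:\partial B^4\to S^2$ is not homotopic to a constant map. Then $\mathrm{Sweep}^1_1(S^3,S^2)\neq\emptyset$; for each $u\in\mathrm{Sweep}^1_1(S^3,S^2)$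 the maximum of $a\mapsto E(u_a)$ on $\overline{B^4}$ is attained; and $$\mathcal W^1_1(S^3,S^2):=\inf_{u\in \mathrm{Sweep}^1_1(S^3,S^2)}\ \max_{a\in\overline{B^4}}E(u_a)>0 .$$ -/

import Mathlib

open MeasureTheory Metric Set
open scoped ContDiff

noncomputable section

/-- The Euclidean space `ℝⁿ`. -/
abbrev Euc (n : ℕ) : Type := EuclideanSpace ℝ (Fin n)

/-- The unit sphere `S³` of `ℝ⁴`; it is also the boundary `∂B⁴`. -/
abbrev S3 : Type := sphere (0 : Euc 4) 1

/-- The unit sphere `S²` of `ℝ³`. -/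
abbrev S2 : Type := sphere (0 : Euc 3) 1

/-- The closed unit ball of `ℝ⁴`. -/
abbrev ClosedB4 : Type := closedBall (0 : Euc 4) 1

/-- The open unit ball of `ℝ⁴`. -/
abbrev OpenB4 : Type := ball (0 : Euc 4) 1

/-- The inclusion of the open ball in the closed ball. -/
def OpenB4.incl (a : OpenB4) : ClosedB4 := ⟨a, ball_subset_closedBall a.2⟩

/-- The inclusion of the boundary `∂B⁴ = S³` in the closed ball. -/
def boundaryIncl (a : S3) : ClosedB4 := ⟨a, sphere_subset_closedBall a.2⟩

/-- The Riemannian volume (surface measure) of the round sphere `S³`. -/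
def volS3 : Measure (S3) := (volume : Measure (Euc 4)).toSphere

/-- The divergence on `S³`, at the point `x`, of a vector field `X` of `ℝ⁴` that is tangent to
`S³`: the trace of `DX(x)` over the tangent space `x^⊥`, i.e. the full trace minus the
normal-normal entry. -/
def divS3 (X : Euc 4 → Euc 4) (x : S3) : ℝ :=
  (∑ i : Fin 4, (fderiv ℝ X (x : Euc 4) (EuclideanSpace.single i 1)) i)
    - inner ℝ (fderiv ℝ X (x : Euc 4) (x : Euc 4)) (x : Euc 4)

/-- `G` is the weak differential `du` of `u : S³ → ℝ³`: it is tangential (each `du_x`, a linear map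
on `T_x S³ = x^⊥`, is extended by `0` on the normal line `ℝ x`), and
`∫ u div X = - ∫ du(X)` for all smooth tangent vector fields `X` of `S³`
(written as restrictions of smooth fields of `ℝ⁴`). -/
def IsWeakDifferential (u : S3 → Euc 3) (G : S3 → (Euc 4 →L[ℝ] Euc 3)) : Prop :=
  (∀ᵐ x ∂volS3, G x (x : Euc 4) = 0) ∧
  ∀ X : Euc 4 → Euc 4, ContDiff ℝ ∞ X → (∀ x : S3, inner ℝ (X x) (x : Euc 4) = 0) →
    ∫ x, divS3 X x • u x ∂volS3 = - ∫ x, G x (X x) ∂volS3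

/-- The Sobolev space `W^{1,2}(S³, S²)`, realised as the set of pairs `(u, du)` in `L² × L²`
with `du` the weak differential of `u` and `|u| = 1` almost everywhere. As `du` is determined
by `u`, this is the usual space of (a.e. classes of) maps `u`; the topology induced by `L² × L²`
is the `W^{1,2}` one: `u_k → u` in `L²` and `du_k → du` in `L²`. -/
def sobolevMaps : Set (Lp (Euc 3) 2 volS3 × Lp (Euc 4 →L[ℝ] Euc 3) 2 volS3) :=
  {p | IsWeakDifferential p.1 p.2 ∧ ∀ᵐ x ∂volS3, p.1 x ∈ sphere (0 : Euc 3) 1}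

/-- `W^{1,2}(S³, S²)` as a topological space. -/
abbrev W12 : Type := ↥sobolevMaps

/-- The underlying map of an element of `W^{1,2}(S³, S²)`, defined up to null sets. -/
def W12.map (u : W12) : S3 → Euc 3 := u.1.1

/-- The differential of an element of `W^{1,2}(S³, S²)`, defined up to null sets. -/
def W12.diff (u : W12) : S3 → (Euc 4 →L[ℝ] Euc 3) := u.1.2

/-- The weak differential is unique up to null sets. -/
theorem weakDifferential_unique {u : S3 → Euc 3} {G₁ G₂ : S3 → (Euc 4 →L[ℝ] Euc 3)}
    (h₁ : IsWeakDifferential u G₁) (h₂ : IsWeakDifferential u G₂)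
    (i₁ : Integrable G₁ volS3) (i₂ : Integrable G₂ volS3) : G₁ =ᵐ[volS3] G₂ := by
  have hemb : MeasurableEmbedding (Subtype.val : S3 → Euc 4) :=
    MeasurableEmbedding.subtype_coe isClosed_sphere.measurableSet
  have bdd : ∀ X : Euc 4 → Euc 4, ContDiff ℝ ∞ X → ∀ G : S3 → (Euc 4 →L[ℝ] Euc 3),
      Integrable G volS3 → Integrable (fun x : S3 => G x (X x)) volS3 := by
    intro X hX G hG
    have hc : Continuous (fun x : S3 => X x) := hX.continuous.comp continuous_subtype_val
    obtain ⟨C, hC⟩ := (isCompact_range hc).isBounded.exists_norm_le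
    refine Integrable.mono' (hG.norm.mul_const C) ?_ (Filter.Eventually.of_forall fun x => ?_)
    · exact (ContinuousLinearMap.aestronglyMeasurable_comp₂ (ContinuousLinearMap.apply ℝ (Euc 3)).flip
        hG.1 hc.aestronglyMeasurable)
    · exact (G x).le_opNorm_of_le (hC _ ⟨x, rfl⟩)
  have key : ∀ i : Fin 4, ∀ᵐ x ∂volS3, G₁ x (EuclideanSpace.single i 1)
      = G₂ x (EuclideanSpace.single i 1) := by
    intro i
    set e : Euc 4 := EuclideanSpace.single i 1
    set f : S3 → Euc 3 := fun x => G₁ x e - G₂ x e with hf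
    let F : Euc 4 → Euc 3 := Function.extend Subtype.val f 0
    have hFv : ∀ x : S3, F x = f x := fun x => Subtype.val_injective.extend_apply _ _ _
    have hfi : Integrable f volS3 :=
      (bdd (fun _ => e) contDiff_const G₁ i₁).sub (bdd (fun _ => e) contDiff_const G₂ i₂)
    have hFi : Integrable F (volS3.map Subtype.val) := by
      rw [hemb.integrable_map_iff]
      exact hfi.congr (Filter.Eventually.of_forall fun x => (hFv x).symm)
    have := ae_eq_zero_of_integral_contDiff_smul_eq_zero hFi.locallyIntegrable (by
      intro g hg _
      rw [hemb.integral_map]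
      let X : Euc 4 → Euc 4 := fun x => g x • (e - (inner ℝ e x : ℝ) • x)
      have hX : ContDiff ℝ ∞ X :=
        hg.smul (contDiff_const.sub ((contDiff_const.inner ℝ contDiff_id).smul contDiff_id))
      have hXt : ∀ x : S3, inner ℝ (X x) (x : Euc 4) = 0 := by
        intro x
        have : ‖(x : Euc 4)‖ = 1 := by simp
        simp [X, inner_smul_left, inner_sub_left, this]
      have hh := (h₁.2 X hX hXt).symm.trans (h₂.2 X hX hXt)
      have h0 : ∫ x, (G₁ x (X x) - G₂ x (X x)) ∂volS3 = 0 := by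
        rw [integral_sub (bdd X hX _ i₁) (bdd X hX _ i₂), neg_inj.mp hh, sub_self]
      rw [← h0]
      refine integral_congr_ae ?_
      filter_upwards [h₁.1, h₂.1] with x a b
      simp [hFv, hf, X, a, b, smul_sub])
    rw [hemb.ae_map_iff] at this
    filter_upwards [this] with x hx
    rw [hFv] at hx
    exact sub_eq_zero.mp hx
  filter_upwards [ae_all_iff.mpr key] with x hx
  apply ContinuousLinearMap.coe_injective
  exact (EuclideanSpace.basisFun (Fin 4) ℝ).toBasis.ext (by simpa using hx)

/-- An element of `W^{1,2}(S³, S²)` is determined by its underlying a.e. class of maps. -/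
theorem W12.eq_of_map_ae_eq (u v : W12) (h : u.map =ᵐ[volS3] v.map) : u = v := by
  have : IsFiniteMeasure volS3 := by unfold volS3; infer_instance
  have h1 : u.1.1 = v.1.1 := Lp.ext h
  have i : ∀ w : W12, Integrable w.1.2 volS3 := fun w => (Lp.memLp w.1.2).integrable (by norm_num)
  have h2 : u.1.2 = v.1.2 := by
    apply Lp.ext
    have hv := v.2.1
    rw [← h1] at hv
    exact weakDifferential_unique u.2.1 hv (i u) (i v)
  exact Subtype.ext (Prod.ext h1 h2)

/-- The Dirichlet energy `E(u) = ∫_{S³} |du|² dvol`, with the Hilbert-Schmidt norm of `du`. -/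
def dirichletEnergy (u : W12) : ℝ :=
  ∫ x, ∑ i : Fin 4, ‖u.diff x (EuclideanSpace.single i 1)‖ ^ 2 ∂volS3

/-- The class `Sweep¹₁(S³, S²)`: the families `u ∈ C⁰(closed B⁴, W^{1,2}(S³, S²))` which
on the open ball are represented by a map in `C⁰(B⁴ × S³, S²)`, and such that
`u_a` is (a.e.) a constant `c a ∈ S²` for each `a ∈ ∂B⁴`, where `c : ∂B⁴ → S²`
is not homotopic to a constant map. -/
def Sweep11 : Set C(ClosedB4, W12) :=
  {u | (∃ v : C(OpenB4 × S3, S2), ∀ a : OpenB4,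
          ∀ᵐ x ∂volS3, (u a.incl).map x = (v (a, x) : Euc 3)) ∧
       ∃ c : C(S3, S2),
          (∀ a : S3, ∀ᵐ x ∂volS3, (u (boundaryIncl a)).map x = (c a : Euc 3)) ∧
          ¬ c.Nullhomotopic}

/-- The width `inf_{u ∈ Sweep¹₁} max_{a ∈ closed B⁴} E(u_a)`. -/
def width11 : ℝ := ⨅ u : Sweep11, ⨆ a : ClosedB4, dirichletEnergy (u.1 a)

end

noncomputable section

/-! Positivity. The mean `∫ u_a` depends continuously on `a`, and for `|a| = 1` it equals `vol(S³) •
c(a)`. If it never vanished, the normalized mean would extend `c` to the contractible ball, making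
`c` nullhomotopic. So some `u_a` has mean zero (`exists_integral_map_eq_zero`). Since `|u_a| = 1`, a
Poincaré inequality then gives `E(u_a) ≥ vol(S³) / (3π²)` (`W12.le_dirichletEnergy`), a bound
independent of the sweepout.

The Poincaré inequality uses the group `S³` of unit quaternions. Each left translation is reached
within time `π` by the flow of a Killing field `x ↦ p x`, so translating a test function `φ` changes
`∫ u φ` by at most `π √E ‖φ‖₂`. Averaging over the group replaces the translated integral by a
product of means, which is zero.

The maximum is attained because `E` is continuous and the closed ball is compact.

Nonemptiness. The family is the Hopf map composed with the conformal maps `moebius a` of `S³`, which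
degenerate to the constant `a` as `|a| → 1`. The boundary map is then the Hopf map itself.
Continuity up to the boundary in `W^{1,2}` holds because the conformal factor tends to zero in `L²`
on a 3-sphere, even though it concentrates near `-a`.

The Hopf map is essential: a nullhomotopy would lift to a homotopy from the identity of `S³` to a
map into one fibre, so `S³` would be contractible. This is excluded by the no-retraction theorem,
proved by integrating Jacobian determinants. -/

instance : IsFiniteMeasure volS3 := by unfold volS3; infer_instance

/-! ### Invariance of the volume of `S³` under linear isometries -/

theorem norm_S3 (x : S3) : ‖(x : Euc 4)‖ = 1 := norm_eq_of_mem_sphere x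

/-- The restriction of a linear isometry of `ℝ⁴` to `S³`. -/
def sphereMap (f : Euc 4 ≃ₗᵢ[ℝ] Euc 4) (x : S3) : S3 :=
  ⟨f x, by simp⟩

theorem continuous_sphereMap (f : Euc 4 ≃ₗᵢ[ℝ] Euc 4) : Continuous (sphereMap f) :=
  (f.continuous.comp continuous_subtype_val).subtype_mk _

/-- Up to a constant, the spherical measure of `s` is the Lebesgue measure of the cone `(0,1) • s`,
and a linear isometry commutes with forming cones and preserves Lebesgue measure. -/
theorem measurePreserving_sphereMap (f : Euc 4 ≃ₗᵢ[ℝ] Euc 4) :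
    MeasurePreserving (sphereMap f) volS3 volS3 := by
  have hm : Measurable (sphereMap f) := (continuous_sphereMap f).measurable
  refine ⟨hm, Measure.ext fun s hs => ?_⟩
  rw [Measure.map_apply hm hs, volS3, Measure.toSphere_apply' _ hs,
    Measure.toSphere_apply' _ (hm hs)]
  congr 1
  refine Eq.trans (congrArg _ ?_) (f.measurePreserving.measure_preimage_equiv
    (f := f.toHomeomorph.toMeasurableEquiv) _)
  ext y
  simp only [mem_smul, mem_image, mem_preimage]
  constructor
  · rintro ⟨r, hr, _, ⟨x, hx, rfl⟩, rfl⟩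
    exact ⟨r, hr, _, ⟨_, hx, rfl⟩, (map_smul f r _).symm⟩
  · rintro ⟨r, hr, _, ⟨x, hx, rfl⟩, h⟩
    change r • (x : Euc 4) = f y at h
    refine ⟨r, hr, _, ⟨sphereMap f.symm x, ?_, rfl⟩, ?_⟩
    · have : sphereMap f (sphereMap f.symm x) = x := by ext; simp [sphereMap]
      simpa [this] using hx
    · apply f.injective
      simpa [sphereMap] using h

theorem integral_sphere_comp {F : Type*} [NormedAddCommGroup F] [NormedSpace ℝ F]
    (f : Euc 4 ≃ₗᵢ[ℝ] Euc 4) (g : Euc 4 → F) :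
    ∫ x : S3, g (f x) ∂volS3 = ∫ x : S3, g x ∂volS3 := by
  have he : MeasurableEmbedding (sphereMap f) := by
    let e : S3 ≃ₜ S3 :=
      { toFun := sphereMap f
        invFun := sphereMap f.symm
        left_inv := fun x => by ext; simp [sphereMap]
        right_inv := fun x => by ext; simp [sphereMap]
        continuous_toFun := continuous_sphereMap f
        continuous_invFun := continuous_sphereMap f.symm }
    exact e.measurableEmbedding
  exact (measurePreserving_sphereMap f).integral_comp he (fun x : S3 => g x)

/-! ### Quaternions and their one-parameter groups -/

theorem norm_sq_euc4 (x : Euc 4) : ‖x‖ ^ 2 = x 0 ^ 2 + x 1 ^ 2 + x 2 ^ 2 + x 3 ^ 2 := by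
  simp [EuclideanSpace.norm_sq_eq, Fin.sum_univ_four]

/-- Quaternion multiplication on `ℝ⁴`. -/
def qmul (x y : Euc 4) : Euc 4 :=
  !₂[x 0 * y 0 - x 1 * y 1 - x 2 * y 2 - x 3 * y 3,
     x 0 * y 1 + x 1 * y 0 + x 2 * y 3 - x 3 * y 2,
     x 0 * y 2 - x 1 * y 3 + x 2 * y 0 + x 3 * y 1,
     x 0 * y 3 + x 1 * y 2 - x 2 * y 1 + x 3 * y 0]

/-- Euler's four-square identity. -/
theorem norm_qmul (x y : Euc 4) : ‖qmul x y‖ = ‖x‖ * ‖y‖ := by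
  rw [← pow_left_inj₀ (norm_nonneg _) (by positivity) two_ne_zero, mul_pow, norm_sq_euc4,
    norm_sq_euc4, norm_sq_euc4]
  simp [qmul]
  ring

theorem qmul_add (x y z : Euc 4) : qmul x (y + z) = qmul x y + qmul x z := by
  ext i
  fin_cases i <;> simp [qmul] <;> ring

theorem add_qmul (x y z : Euc 4) : qmul (x + y) z = qmul x z + qmul y z := by
  ext i
  fin_cases i <;> simp [qmul] <;> ring

theorem qmul_smul (r : ℝ) (x y : Euc 4) : qmul x (r • y) = r • qmul x y := by
  ext i
  fin_cases i <;> simp [qmul] <;> ring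

theorem smul_qmul (r : ℝ) (x y : Euc 4) : qmul (r • x) y = r • qmul x y := by
  ext i
  fin_cases i <;> simp [qmul] <;> ring

/-- Left multiplication by a unit quaternion. -/
def qmulLeft (g : S3) : Euc 4 ≃ₗᵢ[ℝ] Euc 4 :=
  LinearIsometry.toLinearIsometryEquiv
    { toFun := fun x => qmul g x
      map_add' := fun x y => qmul_add _ x y
      map_smul' := fun r x => qmul_smul r _ x
      norm_map' := fun x => by
        change ‖qmul g x‖ = _
        rw [norm_qmul, norm_S3, one_mul] } rfl

/-- Right multiplication by a unit quaternion. -/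
def qmulRight (g : S3) : Euc 4 ≃ₗᵢ[ℝ] Euc 4 :=
  LinearIsometry.toLinearIsometryEquiv
    { toFun := fun x => qmul x g
      map_add' := fun x y => add_qmul x y _
      map_smul' := fun r x => smul_qmul r x _
      norm_map' := fun x => by
        change ‖qmul x g‖ = _
        rw [norm_qmul, norm_S3, mul_one] } rfl

@[simp] theorem qmulLeft_apply (g : S3) (x : Euc 4) : qmulLeft g x = qmul g x := rfl

@[simp] theorem qmulRight_apply (g : S3) (x : Euc 4) : qmulRight g x = qmul x g := rfl

theorem continuous_qmul : Continuous fun p : Euc 4 × Euc 4 => qmul p.1 p.2 := by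
  unfold qmul
  refine (PiLp.continuous_toLp 2 _).comp (continuous_pi fun i => ?_)
  fin_cases i <;> simp <;> fun_prop

/-- The flow of the unit imaginary quaternion `p` acting on `ℝ⁴` on the left. -/
def qflow (p : S3) (t : ℝ) (x : Euc 4) : Euc 4 :=
  Real.cos t • x + Real.sin t • qmul p x

theorem sum_sq_S3 (x : S3) :
    (x : Euc 4) 0 ^ 2 + (x : Euc 4) 1 ^ 2 + (x : Euc 4) 2 ^ 2 + (x : Euc 4) 3 ^ 2 = 1 := by
  rw [← norm_sq_euc4, norm_S3, one_pow]

theorem inner_euc4 (x y : Euc 4) :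
    inner ℝ x y = x 0 * y 0 + x 1 * y 1 + x 2 * y 2 + x 3 * y 3 := by
  simp [PiLp.inner_apply, Fin.sum_univ_four, mul_comm]

/-- A unit imaginary quaternion squares to `-1`; hence `qflow p` is the exponential `exp(t p)`
acting on the left. -/
theorem qmul_qmul_self {p : S3} (hp : (p : Euc 4) 0 = 0) (x : Euc 4) :
    qmul p (qmul p x) = -x := by
  have := sum_sq_S3 p
  rw [hp] at this
  ext i
  fin_cases i <;> simp [qmul, hp] <;> linear_combination (-(x _)) * this

theorem inner_qmul_self {p : S3} (hp : (p : Euc 4) 0 = 0) (x : Euc 4) :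
    inner ℝ (qmul p x) x = 0 := by
  rw [inner_euc4]
  simp [qmul, hp]
  ring

theorem norm_qflow {p : S3} (hp : (p : Euc 4) 0 = 0) (t : ℝ) (x : Euc 4) :
    ‖qflow p t x‖ = ‖x‖ := by
  have h : ‖qflow p t x‖ ^ 2 = ‖x‖ ^ 2 := by
    rw [qflow, norm_add_sq_real, norm_smul, norm_smul, norm_qmul, norm_S3, inner_smul_left,
      inner_smul_right, real_inner_comm, inner_qmul_self hp, mul_pow, mul_pow, Real.norm_eq_abs,
      Real.norm_eq_abs, sq_abs, sq_abs]
    linear_combination ‖x‖ ^ 2 * Real.sin_sq_add_cos_sq t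
  exact (pow_left_inj₀ (norm_nonneg _) (norm_nonneg _) two_ne_zero).mp h

/-- The flow of a unit imaginary quaternion consists of isometries. -/
def qflowIsometry {p : S3} (hp : (p : Euc 4) 0 = 0) (t : ℝ) : Euc 4 ≃ₗᵢ[ℝ] Euc 4 :=
  LinearIsometry.toLinearIsometryEquiv
    { toFun := qflow p t
      map_add' := fun x y => by
        change qflow p t (x + y) = qflow p t x + qflow p t y
        simp only [qflow, ← qmulLeft_apply, map_add, smul_add]
        abel
      map_smul' := fun r x => by
        simp only [qflow, ← qmulLeft_apply, map_smul, smul_add, RingHom.id_apply]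
        rw [smul_comm r, smul_comm r]
      norm_map' := norm_qflow hp t } rfl

@[simp] theorem qflowIsometry_apply {p : S3} (hp : (p : Euc 4) 0 = 0) (t : ℝ) (x : Euc 4) :
    qflowIsometry hp t x = qflow p t x := rfl

theorem qmul_qflow {p : S3} (hp : (p : Euc 4) 0 = 0) (t : ℝ) (x : Euc 4) :
    qmul p (qflow p t x) = -Real.sin t • x + Real.cos t • qmul p x := by
  simp only [qflow, ← qmulLeft_apply, map_add, map_smul]
  simp only [qmulLeft_apply, qmul_qmul_self hp]
  simp [add_comm]

theorem qflow_zero (p : S3) (x : Euc 4) : qflow p 0 x = x := by simp [qflow]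

theorem hasDerivAt_qflow {p : S3} (hp : (p : Euc 4) 0 = 0) (x : Euc 4) (t : ℝ) :
    HasDerivAt (fun t => qflow p t x) (qmul p (qflow p t x)) t := by
  rw [qmul_qflow hp]
  exact ((Real.hasDerivAt_cos t).smul_const x).add ((Real.hasDerivAt_sin t).smul_const _)

theorem continuous_qflow (p : S3) : Continuous fun q : ℝ × Euc 4 => qflow p q.1 q.2 := by
  have : Continuous fun x => qmul p x := (qmulLeft p).continuous
  unfold qflow
  fun_prop

/-- Every unit quaternion lies on a one-parameter group. -/
theorem exists_qflow_eq_qmul (g : S3) :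
    ∃ p : S3, (p : Euc 4) 0 = 0 ∧ ∃ t ∈ Icc 0 Real.pi, ∀ x, qflow p t x = qmul g x := by
  have hg := sum_sq_S3 g
  -- Polar form `g = cos t + p sin t`: `s` is the length of the imaginary part, `p` its direction
  -- and `t = arccos (g 0)`. When `s = 0`, `g = ±1` and any unit imaginary `p` serves.
  set s := √(1 - (g : Euc 4) 0 ^ 2) with hs
  have h0 : 0 ≤ 1 - (g : Euc 4) 0 ^ 2 := by
    nlinarith [sq_nonneg ((g : Euc 4) 1), sq_nonneg ((g : Euc 4) 2), sq_nonneg ((g : Euc 4) 3)]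
  have hss : s ^ 2 = 1 - (g : Euc 4) 0 ^ 2 := Real.sq_sqrt h0
  have hlo : -1 ≤ (g : Euc 4) 0 := by nlinarith
  have hhi : (g : Euc 4) 0 ≤ 1 := by nlinarith
  have key : ∃ p : S3, (p : Euc 4) 0 = 0 ∧ ∀ i : Fin 3,
      s * (p : Euc 4) i.succ = (g : Euc 4) i.succ := by
    by_cases h : s = 0
    · refine ⟨⟨!₂[0, 1, 0, 0], ?_⟩, by simp, ?_⟩
      · simp [EuclideanSpace.norm_eq, Fin.sum_univ_four]
      · rw [h] at hss
        have h1 : (g : Euc 4) 1 = 0 := by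
          nlinarith [sq_nonneg ((g : Euc 4) 2), sq_nonneg ((g : Euc 4) 3)]
        have h2 : (g : Euc 4) 2 = 0 := by
          nlinarith [sq_nonneg ((g : Euc 4) 2), sq_nonneg ((g : Euc 4) 3)]
        have h3 : (g : Euc 4) 3 = 0 := by
          nlinarith [sq_nonneg ((g : Euc 4) 2), sq_nonneg ((g : Euc 4) 3)]
        intro i
        fin_cases i <;> simp [h, h1, h2, h3]
    · refine ⟨⟨!₂[0, (g : Euc 4) 1 / s, (g : Euc 4) 2 / s, (g : Euc 4) 3 / s], ?_⟩, by simp, ?_⟩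
      · simp only [mem_sphere_iff_norm, sub_zero]
        rw [← pow_left_inj₀ (norm_nonneg _) zero_le_one two_ne_zero, norm_sq_euc4]
        simp only [Matrix.cons_val]
        field_simp
        linarith
      · intro i
        fin_cases i <;> simp <;> field_simp
  obtain ⟨p, hp, hps⟩ := key
  refine ⟨p, hp, Real.arccos ((g : Euc 4) 0), ⟨Real.arccos_nonneg _, Real.arccos_le_pi _⟩,
    fun x => ?_⟩
  have h1 := hps 0
  have h2 := hps 1
  have h3 := hps 2
  simp only [Fin.reduceSucc, Fin.succ_zero_eq_one, Fin.succ_one_eq_two] at h1 h2 h3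
  ext i
  fin_cases i <;>
    simp [qflow, Real.cos_arccos hlo hhi, Real.sin_arccos, ← hs, qmul, hp,
      ← h1, ← h2, ← h3] <;> ring

/-- The restriction of the flow to `S³`. -/
def sphereFlow {p : S3} (hp : (p : Euc 4) 0 = 0) (t : ℝ) (x : S3) : S3 :=
  ⟨qflow p t x, by simp [norm_qflow hp]⟩

theorem continuous_sphereFlow {p : S3} (hp : (p : Euc 4) 0 = 0) (t : ℝ) :
    Continuous (sphereFlow hp t) :=
  Continuous.subtype_mk ((continuous_qflow p).comp
    (continuous_const.prodMk continuous_subtype_val)) _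

/-! ### Differentiation of integrals along Killing flows -/

theorem exists_bound_S3 {F : Type*} [SeminormedAddCommGroup F] {f : S3 → F} (hf : Continuous f) :
    ∃ C, ∀ x, ‖f x‖ ≤ C := by
  obtain ⟨C, hC⟩ := (isCompact_range hf).isBounded.exists_norm_le
  exact ⟨C, fun x => hC _ ⟨x, rfl⟩⟩

theorem integrable_S3 {F : Type*} [NormedAddCommGroup F] {f : S3 → F} (hf : Continuous f) :
    Integrable f volS3 := by
  obtain ⟨C, hC⟩ := exists_bound_S3 hf
  exact (integrable_const C).mono' hf.aestronglyMeasurable_of_compactSpace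
    (Filter.Eventually.of_forall hC)

section Flow

variable {F : Type*} [NormedAddCommGroup F] [NormedSpace ℝ F] {g : Euc 4 → F}

theorem continuous_comp_S3 (hg : ∀ x : S3, ContDiffAt ℝ 1 g x) : Continuous fun x : S3 => g x :=
  continuous_iff_continuousAt.mpr fun x =>
    ContinuousAt.comp (f := Subtype.val) (hg x).continuousAt continuous_subtype_val.continuousAt

theorem continuous_fderiv_S3 (hg : ∀ x : S3, ContDiffAt ℝ 1 g x) :
    Continuous fun x : S3 => fderiv ℝ g x :=
  continuous_iff_continuousAt.mpr fun x =>
    ContinuousAt.comp (f := Subtype.val) (g := fderiv ℝ g)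
      ((hg x).fderiv_right (m := 0) (by norm_num)).continuousAt continuous_subtype_val.continuousAt

/-- The flow stays on the compact sphere, so the derivative is dominated by a constant times `‖w‖`.
The weight is only integrable, so that a coordinate of a Sobolev map can be inserted. -/
theorem hasDerivAt_integral_flow (hg : ∀ x : S3, ContDiffAt ℝ 1 g x)
    {w : S3 → ℝ} (hw : Integrable w volS3) {p : S3} (hp : (p : Euc 4) 0 = 0) (t : ℝ) :
    HasDerivAt (fun t => ∫ x : S3, w x • g (qflow p t x) ∂volS3)
      (∫ x : S3, w x • fderiv ℝ g (qflow p t x) (qmul p (qflow p t x)) ∂volS3) t := by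
  have hc := continuous_comp_S3 hg
  have hD : Continuous fun x : S3 => fderiv ℝ g x (qmul p x) :=
    (continuous_fderiv_S3 hg).clm_apply ((qmulLeft p).continuous.comp continuous_subtype_val)
  obtain ⟨C, hC⟩ := exists_bound_S3 hD
  obtain ⟨B, hB⟩ := exists_bound_S3 hc
  have m1 : ∀ s, AEStronglyMeasurable (fun x : S3 => w x • g (qflow p s x)) volS3 := fun s =>
    hw.1.smul (hc.comp (continuous_sphereFlow hp s)).aestronglyMeasurable
  refine (hasDerivAt_integral_of_dominated_loc_of_deriv_le
    (F := fun s (x : S3) => w x • g (qflow p s x))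
    (F' := fun s (x : S3) => w x • fderiv ℝ g (qflow p s x) (qmul p (qflow p s x)))
    (bound := fun x => ‖w x‖ * C) (s := univ) Filter.univ_mem
    (Filter.Eventually.of_forall m1) ?_ ?_ ?_ (hw.norm.mul_const C) ?_).2
  · refine Integrable.mono' (hw.norm.mul_const B) (m1 t) (Filter.Eventually.of_forall fun x => ?_)
    rw [norm_smul]
    exact mul_le_mul_of_nonneg_left (hB (sphereFlow hp t x)) (norm_nonneg _)
  · exact hw.1.smul (hD.comp (continuous_sphereFlow hp t)).aestronglyMeasurable
  · refine Filter.Eventually.of_forall fun x s _ => ?_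
    rw [norm_smul]
    exact mul_le_mul_of_nonneg_left (hC (sphereFlow hp s x)) (norm_nonneg _)
  · refine Filter.Eventually.of_forall fun x s _ => ?_
    exact (HasFDerivAt.comp_hasDerivAt s
      ((hg (sphereFlow hp s x)).differentiableAt (by norm_num)).hasFDerivAt
      (hasDerivAt_qflow hp x s)).const_smul (w x)

/-- The derivative along a Killing field of the sphere integrates to zero. -/
theorem integral_fderiv_qmul (hg : ∀ x : S3, ContDiffAt ℝ 1 g x) {p : S3}
    (hp : (p : Euc 4) 0 = 0) :
    ∫ x : S3, fderiv ℝ g x (qmul p x) ∂volS3 = 0 := by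
  have h := hasDerivAt_integral_flow hg (integrable_const (1 : ℝ)) hp 0
  -- The flow preserves the volume, so the integral is constant in time and its derivative at `0`
  -- vanishes.
  have hconst : (fun t => ∫ x : S3, (1 : ℝ) • g (qflow p t x) ∂volS3) =
      fun _ => ∫ x : S3, g x ∂volS3 := by
    funext t
    simpa using integral_sphere_comp (qflowIsometry hp t) g
  rw [hconst] at h
  simpa [qflow_zero] using h.unique (hasDerivAt_const _ _)

end Flow

/-! ### The Killing frame, the divergence, and classical differentials -/

/-- The standard imaginary units. -/
def qunit (j : Fin 3) : S3 := ⟨EuclideanSpace.single j.succ 1, by simp⟩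

theorem qunit_zero (j : Fin 3) : (qunit j : Euc 4) 0 = 0 := by
  fin_cases j <;> simp [qunit]

theorem euc4_eq_sum (v : Euc 4) : v = v 0 • EuclideanSpace.single 0 (1 : ℝ)
    + v 1 • EuclideanSpace.single 1 (1 : ℝ) + v 2 • EuclideanSpace.single 2 (1 : ℝ)
    + v 3 • EuclideanSpace.single 3 (1 : ℝ) := by
  ext i
  fin_cases i <;> simp

theorem clm_euc4_apply {F : Type*} [NormedAddCommGroup F] [NormedSpace ℝ F] (L : Euc 4 →L[ℝ] F)
    (v : Euc 4) : L v = v 0 • L (EuclideanSpace.single 0 1)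
    + v 1 • L (EuclideanSpace.single 1 1) + v 2 • L (EuclideanSpace.single 2 1)
    + v 3 • L (EuclideanSpace.single 3 1) := by
  conv_lhs => rw [euc4_eq_sum v]
  simp only [map_add, map_smul]

theorem qmul_qunit (x : Euc 4) :
    qmul (qunit 0) x = !₂[-x 1, x 0, -x 3, x 2] ∧
    qmul (qunit 1) x = !₂[-x 2, x 3, x 0, -x 1] ∧
    qmul (qunit 2) x = !₂[-x 3, -x 2, x 1, x 0] := by
  refine ⟨?_, ?_, ?_⟩ <;> ext i <;> fin_cases i <;> simp [qunit, qmul]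

/-- The vectors `i x`, `j x`, `k x` form an orthonormal basis of `x^⊥`. -/
theorem sum_inner_qmul_smul (x : S3) {v : Euc 4} (hv : inner ℝ v (x : Euc 4) = 0) :
    ∑ j, inner ℝ v (qmul (qunit j) x) • qmul (qunit j) (x : Euc 4) = v := by
  obtain ⟨h0, h1, h2⟩ := qmul_qunit x
  have hx := sum_sq_S3 x
  rw [inner_euc4] at hv
  rw [Fin.sum_univ_three, h0, h1, h2]
  simp only [inner_euc4]
  ext i
  fin_cases i <;> simp
  · linear_combination v 0 * hx - (x : Euc 4) 0 * hv
  · linear_combination v 1 * hx - (x : Euc 4) 1 * hv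
  · linear_combination v 2 * hx - (x : Euc 4) 2 * hv
  · linear_combination v 3 * hx - (x : Euc 4) 3 * hv

/-- The tangential divergence in the frame of the left-invariant Killing fields. -/
theorem divS3_eq_sum (X : Euc 4 → Euc 4) (x : S3) :
    divS3 X x = ∑ j, inner ℝ (fderiv ℝ X x (qmul (qunit j) x)) (qmul (qunit j) (x : Euc 4)) := by
  obtain ⟨h0, h1, h2⟩ := qmul_qunit x
  have hx := sum_sq_S3 x
  rw [divS3, Fin.sum_univ_three, Fin.sum_univ_four, h0, h1, h2, clm_euc4_apply _ (x : Euc 4),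
    clm_euc4_apply _ !₂[-(x : Euc 4) 1, _, _, _], clm_euc4_apply _ !₂[-(x : Euc 4) 2, _, _, _],
    clm_euc4_apply _ !₂[-(x : Euc 4) 3, _, _, _]]
  simp only [inner_euc4]
  generalize fderiv ℝ X x = L
  generalize L (EuclideanSpace.single 0 1) = L0
  generalize L (EuclideanSpace.single 1 1) = L1
  generalize L (EuclideanSpace.single 2 1) = L2
  generalize L (EuclideanSpace.single 3 1) = L3
  simp
  linear_combination (-(L0 0 + L1 1 + L2 2 + L3 3)) * hx

/-- Killing fields are divergence free, so only the derivative of the factor survives. -/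
theorem divS3_qmul {φ : Euc 4 → ℝ} {x : S3} (hφ : DifferentiableAt ℝ φ x) {p : S3}
    (hp : (p : Euc 4) 0 = 0) :
    divS3 (fun y => φ y • qmul p y) x = fderiv ℝ φ x (qmul p x) := by
  have hq : HasFDerivAt (fun y => qmul p y) ((qmulLeft p).toContinuousLinearEquiv : _ →L[ℝ] _)
    (x : Euc 4) := (qmulLeft p).toContinuousLinearEquiv.hasFDerivAt
  have h : fderiv ℝ (fun y => φ y • qmul p y) x = _ := (hφ.hasFDerivAt.smul hq).fderiv
  rw [divS3, h]
  have hx := sum_sq_S3 x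
  have e : ∀ v : Euc 4, (qmulLeft p).toContinuousLinearEquiv v = qmul p v := fun v => rfl
  rw [clm_euc4_apply (fderiv ℝ φ x) (qmul p x)]
  simp only [Fin.sum_univ_four, inner_euc4]
  simp [e, qmul, hp]
  ring

/-- A function that is `C¹` near `S³` has the tangential part of its differential as weak
differential. -/
theorem isWeakDifferential_of_contDiffAt {f : Euc 4 → Euc 3} (hf : ∀ x : S3, ContDiffAt ℝ 1 f x) :
    IsWeakDifferential (fun x => f x) (fun x => (fderiv ℝ f x).comp
      (ContinuousLinearMap.id ℝ (Euc 4) - (innerSL ℝ (x : Euc 4)).smulRight (x : Euc 4))) := by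
  refine ⟨Filter.Eventually.of_forall fun x => by simp, fun X hX hXt => ?_⟩
  have hXc : ∀ x : S3, ContDiffAt ℝ 1 X x :=
    fun x => (hX.of_le (by exact_mod_cast le_top)).contDiffAt
  have hXd : ∀ x : S3, HasFDerivAt X (fderiv ℝ X x) x :=
    fun x => ((hXc x).differentiableAt (by norm_num)).hasFDerivAt
  have hfd : ∀ x : S3, HasFDerivAt f (fderiv ℝ f x) x :=
    fun x => ((hf x).differentiableAt (by norm_num)).hasFDerivAt
  let A : Fin 3 → Euc 4 →L[ℝ] Euc 4 := fun j => (qmulLeft (qunit j)).toContinuousLinearEquiv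
  have hA : ∀ j y, A j y = qmul (qunit j) y := fun j y => rfl
  let φ : Fin 3 → Euc 4 → ℝ := fun j y => inner ℝ (X y) (A j y)
  have hφc : ∀ j (x : S3), ContDiffAt ℝ 1 (φ j) x := fun j x =>
    (hXc x).inner ℝ (A j).contDiff.contDiffAt
  have hφd : ∀ j (x : S3), fderiv ℝ (φ j) x (A j x) = inner ℝ (fderiv ℝ X x (A j x)) (A j x) := by
    intro j x
    have h := ((hXd x).inner ℝ ((A j).hasFDerivAt (x := (x : Euc 4)))).fderiv
    change fderiv ℝ (φ j) x = _ at h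
    rw [h]
    simp only [ContinuousLinearMap.comp_apply, ContinuousLinearMap.prod_apply, fderivInnerCLM_apply]
    -- The derivative of the frame field `A j` along itself is `-x`, which is normal, hence
    -- orthogonal to `X`.
    rw [hA j (A j x), hA j x, qmul_qmul_self (qunit_zero j), inner_neg_right, hXt]
    simp
  have hgc : ∀ j (x : S3), ContDiffAt ℝ 1 (fun y => φ j y • f y) x := fun j x =>
    (hφc j x).smul (hf x)
  have hgd : ∀ j (x : S3), fderiv ℝ (fun y => φ j y • f y) x (A j x) =
      φ j x • fderiv ℝ f x (A j x) + inner ℝ (fderiv ℝ X x (A j x)) (A j x) • f x := by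
    intro j x
    have h : fderiv ℝ (fun y => φ j y • f y) x = _ :=
      (((hφc j x).differentiableAt (by norm_num)).hasFDerivAt.smul (hfd x)).fderiv
    rw [h, ← hφd]
    simp
  -- With `φ j` the components of `X` in the frame, the product rule writes `div X • f + df(X)` as a
  -- sum of derivatives along Killing fields, each of integral zero.
  have key : ∀ x : S3, divS3 X x • f x =
      (∑ j, fderiv ℝ (fun y => φ j y • f y) x (A j x)) - fderiv ℝ f x (X x) := by
    intro x
    have h := congrArg (fderiv ℝ f x) (sum_inner_qmul_smul x (hXt x))
    rw [map_sum] at h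
    rw [← h, divS3_eq_sum, Finset.sum_smul, ← Finset.sum_sub_distrib]
    refine Finset.sum_congr rfl fun j _ => ?_
    rw [hgd, map_smul]
    simp [hA, φ]
  have hc1 : ∀ j, Continuous fun x : S3 => fderiv ℝ (fun y => φ j y • f y) x (A j x) := fun j =>
    (continuous_fderiv_S3 (hgc j)).clm_apply ((A j).continuous.comp continuous_subtype_val)
  have hc2 : Continuous fun x : S3 => fderiv ℝ f x (X x) :=
    (continuous_fderiv_S3 hf).clm_apply (hX.continuous.comp continuous_subtype_val)
  simp only [key]
  rw [integral_sub (integrable_finsetSum _ fun j _ => integrable_S3 (hc1 j)) (integrable_S3 hc2),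
    integral_finsetSum _ fun j _ => integrable_S3 (hc1 j)]
  have h0 : ∀ j, ∫ x : S3, fderiv ℝ (fun y => φ j y • f y) x (A j x) ∂volS3 = 0 := fun j =>
    integral_fderiv_qmul (hgc j) (qunit_zero j)
  have h1 : ∀ x : S3, ((fderiv ℝ f x).comp (ContinuousLinearMap.id ℝ (Euc 4) -
      (innerSL ℝ (x : Euc 4)).smulRight (x : Euc 4))) (X x) = fderiv ℝ f x (X x) := by
    intro x
    have := hXt x
    rw [real_inner_comm] at this
    simp [this]
  simp only [h0, h1]
  simp

/-! ### The Poincaré inequality -/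

section L2

variable {α : Type*} [MeasurableSpace α] {μ : Measure α}

theorem inner_toLp_eq_integral {f g : α → ℝ} (hf : MemLp f 2 μ) (hg : MemLp g 2 μ) :
    inner ℝ (hf.toLp f) (hg.toLp g) = ∫ x, f x * g x ∂μ := by
  rw [L2.inner_def]
  refine integral_congr_ae ?_
  filter_upwards [hf.coeFn_toLp, hg.coeFn_toLp] with x h1 h2
  simp [h1, h2, mul_comm]

theorem norm_toLp_eq_sqrt_integral {f : α → ℝ} (hf : MemLp f 2 μ) :
    ‖hf.toLp f‖ = √(∫ x, f x ^ 2 ∂μ) := by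
  rw [norm_eq_sqrt_real_inner, inner_toLp_eq_integral]
  simp only [sq]

/-- The Cauchy–Schwarz inequality for integrals. -/
theorem abs_integral_mul_le {f g : α → ℝ} (hf : MemLp f 2 μ) (hg : MemLp g 2 μ) :
    |∫ x, f x * g x ∂μ| ≤ √(∫ x, f x ^ 2 ∂μ) * √(∫ x, g x ^ 2 ∂μ) := by
  rw [← inner_toLp_eq_integral hf hg, ← norm_toLp_eq_sqrt_integral hf,
    ← norm_toLp_eq_sqrt_integral hg]
  exact abs_real_inner_le_norm _ _

end L2

theorem memLp_S3 {F : Type*} [NormedAddCommGroup F] {f : S3 → F} (hf : Continuous f) :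
    MemLp f 2 volS3 := by
  obtain ⟨C, hC⟩ := exists_bound_S3 hf
  exact MemLp.of_bound hf.aestronglyMeasurable_of_compactSpace C (Filter.Eventually.of_forall hC)

/-- Restrictions of smooth functions are dense in `L²(S³)`. -/
theorem exists_contDiff_norm_toLp_sub_le {f : S3 → ℝ} (hf : MemLp f 2 volS3) {ε : ℝ} (hε : 0 < ε) :
    ∃ φ : Euc 4 → ℝ, ∃ hφ : ContDiff ℝ ∞ φ,
      ‖hf.toLp f - (memLp_S3 (hφ.continuous.comp continuous_subtype_val)).toLp (fun x : S3 => φ x)‖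
        ≤ ε := by
  have hemb : MeasurableEmbedding (Subtype.val : S3 → Euc 4) :=
    MeasurableEmbedding.subtype_coe isClosed_sphere.measurableSet
  let F : Euc 4 → ℝ := Function.extend Subtype.val f 0
  have hFv : F ∘ (Subtype.val : S3 → Euc 4) = f :=
    funext fun x => Subtype.val_injective.extend_apply _ _ _
  have hF : MemLp F 2 (volS3.map Subtype.val) := by
    rw [hemb.memLp_map_measure_iff, hFv]
    exact hf
  obtain ⟨φ, -, hφ, h⟩ := hF.exist_eLpNorm_sub_le (by norm_num) (by norm_num) hε
  refine ⟨φ, hφ, ?_⟩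
  rw [hemb.eLpNorm_map_measure] at h
  rw [← MemLp.toLp_sub, Lp.norm_toLp]
  refine ENNReal.toReal_le_of_le_ofReal hε.le (le_of_eq_of_le ?_ h)
  congr 1
  funext x
  simp [← hFv]

/-- The operator norm is at most the Hilbert–Schmidt norm; the estimates use the former, the energy
the latter. -/
theorem norm_sq_le_sum_norm_sq {F : Type*} [NormedAddCommGroup F] [NormedSpace ℝ F]
    (L : Euc 4 →L[ℝ] F) : ‖L‖ ^ 2 ≤ ∑ i, ‖L (EuclideanSpace.single i 1)‖ ^ 2 := by
  have h : ‖L‖ ≤ √(∑ i, ‖L (EuclideanSpace.single i 1)‖ ^ 2) := by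
    refine L.opNorm_le_bound (Real.sqrt_nonneg _) fun v => ?_
    have hv : L v = ∑ i, v i • L (EuclideanSpace.single i 1) := by
      rw [clm_euc4_apply, Fin.sum_univ_four]
    rw [hv, EuclideanSpace.norm_eq, mul_comm]
    refine (norm_sum_le _ _).trans ?_
    simp only [norm_smul]
    exact Real.sum_mul_le_sqrt_mul_sqrt _ _ _
  rw [← Real.le_sqrt (norm_nonneg _) (Finset.sum_nonneg fun i _ => sq_nonneg _)]
  exact h

theorem W12.memLp_map (u : W12) : MemLp u.map 2 volS3 := Lp.memLp u.1.1

theorem W12.memLp_diff (u : W12) : MemLp u.diff 2 volS3 := Lp.memLp u.1.2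

theorem W12.memLp_norm_diff (u : W12) : MemLp (fun x => ‖u.diff x‖) 2 volS3 := u.memLp_diff.norm

theorem W12.integral_norm_diff_sq_le (u : W12) :
    ∫ x, ‖u.diff x‖ ^ 2 ∂volS3 ≤ dirichletEnergy u := by
  refine integral_mono u.memLp_norm_diff.integrable_sq ?_ fun x => norm_sq_le_sum_norm_sq _
  refine integrable_finsetSum _ fun i _ => ?_
  exact ((ContinuousLinearMap.apply ℝ (Euc 3)
    (EuclideanSpace.single i (1 : ℝ))).comp_memLp' u.memLp_diff).norm.integrable_sq

theorem W12.memLp_coord (u : W12) (i : Fin 3) : MemLp (fun x => u.map x i) 2 volS3 :=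
  (EuclideanSpace.proj (𝕜 := ℝ) i : Euc 3 →L[ℝ] ℝ).comp_memLp' u.memLp_map

theorem integrable_smul_of_continuous {F : Type*} [NormedAddCommGroup F] [NormedSpace ℝ F]
    {φ : S3 → ℝ} (hφ : Continuous φ) {f : S3 → F} (hf : Integrable f volS3) :
    Integrable (fun x => φ x • f x) volS3 := by
  obtain ⟨C, hC⟩ := exists_bound_S3 hφ
  refine (hf.norm.const_mul C).mono' (hφ.aestronglyMeasurable.smul hf.1)
    (Filter.Eventually.of_forall fun x => ?_)
  rw [norm_smul]
  exact mul_le_mul_of_nonneg_right (hC x) (norm_nonneg _)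

theorem W12.memLp_diff_qmul (u : W12) (p : S3) :
    MemLp (fun x : S3 => u.diff x (qmul p x)) 2 volS3 := by
  refine MemLp.of_le u.memLp_norm_diff ?_ (Filter.Eventually.of_forall fun x => ?_)
  · exact (ContinuousLinearMap.apply ℝ (Euc 3)).flip.aestronglyMeasurable_comp₂ u.memLp_diff.1
      ((qmulLeft p).continuous.comp continuous_subtype_val).aestronglyMeasurable
  · refine (ContinuousLinearMap.le_opNorm _ _).trans ?_
    rw [norm_qmul, norm_S3, norm_S3, norm_norm]
    simp

/-- Integration by parts along a Killing field. -/
theorem W12.integral_mul_fderiv (u : W12) {φ : Euc 4 → ℝ} (hφ : ContDiff ℝ ∞ φ) {p : S3}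
    (hp : (p : Euc 4) 0 = 0) (i : Fin 3) :
    ∫ x : S3, u.map x i * fderiv ℝ φ x (qmul p x) ∂volS3 =
      -∫ x : S3, φ x * u.diff x (qmul p x) i ∂volS3 := by
  have hq : ContDiff ℝ ∞ fun y => qmul p y := (qmulLeft p).toContinuousLinearEquiv.contDiff
  have h := u.2.1.2 (fun y => φ y • qmul p y) (hφ.smul hq) fun x => by
    rw [inner_smul_left, inner_qmul_self hp, mul_zero]
  simp only [divS3_qmul (hφ.differentiable (by norm_num) _) hp, map_smul] at h
  have i1 : Integrable (fun x : S3 => fderiv ℝ φ x (qmul p x) • u.map x) volS3 :=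
    integrable_smul_of_continuous ((continuous_fderiv_S3 fun x =>
      (hφ.of_le (by exact_mod_cast le_top)).contDiffAt).clm_apply
      ((qmulLeft p).continuous.comp continuous_subtype_val))
      (u.memLp_map.integrable (by norm_num))
  have i2 : Integrable (fun x : S3 => φ x • u.diff x (qmul p x)) volS3 :=
    integrable_smul_of_continuous (hφ.continuous.comp continuous_subtype_val)
      ((u.memLp_diff_qmul p).integrable (by norm_num))
  have h2 := congrArg (EuclideanSpace.proj (𝕜 := ℝ) i : Euc 3 →L[ℝ] ℝ) h
  rw [map_neg] at h2
  have e1 := (EuclideanSpace.proj (𝕜 := ℝ) i : Euc 3 →L[ℝ] ℝ).integral_comp_comm i1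
  have e2 := (EuclideanSpace.proj (𝕜 := ℝ) i : Euc 3 →L[ℝ] ℝ).integral_comp_comm i2
  have h3 := (e1.trans h2).trans (congrArg Neg.neg e2.symm)
  simpa [mul_comm] using h3

theorem qflow_qmul {p : S3} (hp : (p : Euc 4) 0 = 0) (t : ℝ) (x : Euc 4) :
    qflow p t (qmul p x) = qmul p (qflow p t x) := by
  rw [qmul_qflow hp, qflow, qmul_qmul_self hp]
  simp [add_comm]

/-- Integration by parts moves the time derivative from `φ` onto `u`, and the flow preserves the
`L²` norm of `φ`. Cauchy–Schwarz then bounds the speed without any derivative of `φ`, and the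
elapsed time is at most `π`. -/
theorem W12.abs_integral_qflow_sub_le (u : W12) {φ : Euc 4 → ℝ} (hφ : ContDiff ℝ ∞ φ) {p : S3}
    (hp : (p : Euc 4) 0 = 0) (i : Fin 3) {t : ℝ} (ht : t ∈ Icc 0 Real.pi) :
    |(∫ x : S3, u.map x i * φ (qflow p t x) ∂volS3) - ∫ x : S3, u.map x i * φ x ∂volS3| ≤
      Real.pi * √(dirichletEnergy u) * √(∫ x : S3, φ x ^ 2 ∂volS3) := by
  have hd := fun s => hasDerivAt_integral_flow
    (fun x => (hφ.of_le (by exact_mod_cast le_top)).contDiffAt)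
    ((u.memLp_coord i).integrable (by norm_num)) hp s
  have hb : ∀ s, ‖∫ x : S3, u.map x i • fderiv ℝ φ (qflow p s x) (qmul p (qflow p s x)) ∂volS3‖ ≤
      √(dirichletEnergy u) * √(∫ x : S3, φ x ^ 2 ∂volS3) := by
    intro s
    let ψ : Euc 4 → ℝ := fun y => φ (qflow p s y)
    let R : Euc 4 →L[ℝ] Euc 4 := (qflowIsometry hp s).toContinuousLinearEquiv
    have hψ : ContDiff ℝ ∞ ψ := hφ.comp R.contDiff
    -- The flow commutes with multiplication by `p`, so the integrand is the derivative of the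
    -- translated test function `ψ` along the same Killing field.
    have hψd : ∀ x : S3, fderiv ℝ ψ x (qmul p x) =
        fderiv ℝ φ (qflow p s x) (qmul p (qflow p s x)) := by
      intro x
      have : fderiv ℝ ψ x = _ := (HasFDerivAt.comp (x : Euc 4) (f := R)
        (hφ.differentiable (by norm_num) (R x)).hasFDerivAt R.hasFDerivAt).fderiv
      rw [this, ContinuousLinearMap.comp_apply, ← qflow_qmul hp]
      rfl
    have h1 := u.integral_mul_fderiv hψ hp i
    simp only [hψd] at h1
    simp only [smul_eq_mul]
    have hψm : MemLp (fun x : S3 => |ψ x|) 2 volS3 :=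
      memLp_S3 (hψ.continuous.comp continuous_subtype_val).abs
    rw [h1, norm_neg]
    calc ‖∫ x : S3, ψ x * u.diff x (qmul p x) i ∂volS3‖
        ≤ ∫ x : S3, |ψ x| * ‖u.diff x‖ ∂volS3 := by
          refine norm_integral_le_of_norm_le (hψm.integrable_mul u.memLp_norm_diff)
            (Filter.Eventually.of_forall fun x => ?_)
          rw [norm_mul, Real.norm_eq_abs]
          refine mul_le_mul_of_nonneg_left ?_ (abs_nonneg _)
          refine (PiLp.norm_apply_le _ i).trans ((ContinuousLinearMap.le_opNorm _ _).trans ?_)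
          rw [norm_qmul, norm_S3, norm_S3]
          simp
      _ ≤ √(∫ x : S3, |ψ x| ^ 2 ∂volS3) * √(∫ x : S3, ‖u.diff x‖ ^ 2 ∂volS3) :=
          (le_abs_self _).trans (abs_integral_mul_le hψm u.memLp_norm_diff)
      _ ≤ _ := by
          rw [mul_comm]
          have : ∫ x : S3, |ψ x| ^ 2 ∂volS3 = ∫ x : S3, φ x ^ 2 ∂volS3 := by
            simp only [sq_abs]
            exact integral_sphere_comp (qflowIsometry hp s) fun y => φ y ^ 2
          rw [this]
          gcongr
          exact u.integral_norm_diff_sq_le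
  have h := convex_univ.norm_image_sub_le_of_norm_hasDerivWithin_le
    (fun s _ => (hd s).hasDerivWithinAt) (fun s _ => hb s) (mem_univ 0) (mem_univ t)
  simp only [qflow_zero, smul_eq_mul, sub_zero, Real.norm_eq_abs] at h
  refine h.trans ?_
  rw [abs_of_nonneg ht.1, mul_comm, mul_assoc Real.pi]
  exact mul_le_mul_of_nonneg_right ht.2 (by positivity)

theorem volS3_real_univ_pos : 0 < volS3.real univ := by
  rw [measureReal_def, ENNReal.toReal_pos_iff]
  refine ⟨?_, measure_lt_top _ _⟩
  rw [Measure.measure_univ_pos]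
  unfold volS3
  exact Measure.toSphere_ne_zero _

/-- A map of mean zero is bounded in the dual norm by its energy: average the translates of the
test function over the group `S³`. -/
theorem W12.abs_integral_mul_le (u : W12) {φ : Euc 4 → ℝ} (hφ : ContDiff ℝ ∞ φ) {i : Fin 3}
    (hu : ∫ x : S3, u.map x i ∂volS3 = 0) :
    |∫ x : S3, u.map x i * φ x ∂volS3| ≤
      Real.pi * √(dirichletEnergy u) * √(∫ x : S3, φ x ^ 2 ∂volS3) := by
  set M := Real.pi * √(dirichletEnergy u) * √(∫ x : S3, φ x ^ 2 ∂volS3)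
  set c := ∫ x : S3, u.map x i * φ x ∂volS3
  have hui := (u.memLp_coord i).integrable (q := 2) (by norm_num)
  have hg : ∀ g : S3, |(∫ x : S3, u.map x i * φ (qmul g x) ∂volS3) - c| ≤ M := by
    intro g
    obtain ⟨p, hp, t, ht, h⟩ := exists_qflow_eq_qmul g
    simp only [← h]
    exact u.abs_integral_qflow_sub_le hφ hp i ht
  have hcont : Continuous fun q : S3 × S3 => φ (qmul q.1 q.2) :=
    hφ.continuous.comp (continuous_qmul.comp
      (continuous_subtype_val.prodMap continuous_subtype_val))
  obtain ⟨C, hC⟩ := (isCompact_range hcont).isBounded.exists_norm_le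
  have hint : Integrable (Function.uncurry fun g x : S3 => u.map x i * φ (qmul g x))
      (volS3.prod volS3) := by
    have h1 : Integrable (fun q : S3 × S3 => u.map q.2 i) (volS3.prod volS3) := hui.comp_snd volS3
    refine (h1.norm.mul_const C).mono' (h1.1.mul hcont.aestronglyMeasurable)
      (Filter.Eventually.of_forall fun q => ?_)
    simp only [Function.uncurry, norm_mul]
    exact mul_le_mul_of_nonneg_left (hC _ ⟨q, rfl⟩) (norm_nonneg _)
  have hzero : ∫ g : S3, ∫ x : S3, u.map x i * φ (qmul g x) ∂volS3 ∂volS3 = 0 := by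
    rw [integral_integral_swap hint]
    -- For fixed `x`, `g ↦ g x` is an isometry, so averaging over `g` leaves `∫ φ`, independent of
    -- `x`; the mean of `u` then factors out.
    have : ∀ x : S3, ∫ g : S3, u.map x i * φ (qmul g x) ∂volS3 =
        u.map x i * ∫ g : S3, φ g ∂volS3 := by
      intro x
      rw [integral_const_mul]
      congr 1
      exact integral_sphere_comp (qmulRight x) φ
    simp only [this]
    rw [integral_mul_const, hu, zero_mul]
  have hfin : |∫ g : S3, ((∫ x : S3, u.map x i * φ (qmul g x) ∂volS3) - c) ∂volS3| ≤
      M * volS3.real univ := by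
    rw [← Real.norm_eq_abs]
    exact norm_integral_le_of_norm_le_const (Filter.Eventually.of_forall hg)
  have hi : Integrable (fun g : S3 => ∫ x : S3, u.map x i * φ (qmul g x) ∂volS3) volS3 :=
    hint.integral_prod_left
  rw [integral_sub hi (integrable_const _), hzero, integral_const] at hfin
  rw [zero_sub, abs_neg, smul_eq_mul, abs_mul, abs_of_pos volS3_real_univ_pos, mul_comm] at hfin
  exact le_of_mul_le_mul_right hfin volS3_real_univ_pos

/-- The Poincaré inequality. -/
theorem W12.integral_coord_sq_le (u : W12) {i : Fin 3}
    (hu : ∫ x : S3, u.map x i ∂volS3 = 0) :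
    ∫ x : S3, u.map x i ^ 2 ∂volS3 ≤ Real.pi ^ 2 * dirichletEnergy u := by
  set K := Real.pi * √(dirichletEnergy u)
  have hE : 0 ≤ dirichletEnergy u :=
    integral_nonneg fun x => Finset.sum_nonneg fun i _ => sq_nonneg _
  set U := (u.memLp_coord i).toLp _ with hU
  have key : |inner ℝ U U| ≤ K * ‖U‖ := by
    -- The dual bound is a closed condition on the test function and holds on the dense smooth ones,
    -- so it may be tested on `U` itself.
    have hcl : IsClosed {V : Lp ℝ 2 volS3 | |inner ℝ U V| ≤ K * ‖V‖} :=
      isClosed_le (by fun_prop) (by fun_prop)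
    refine hcl.closure_subset_iff.mpr subset_rfl ?_
    rw [Metric.mem_closure_iff]
    intro ε hε
    obtain ⟨φ, hφ, h⟩ := exists_contDiff_norm_toLp_sub_le (u.memLp_coord i) (half_pos hε)
    have hm : MemLp (fun x : S3 => φ x) 2 volS3 :=
      memLp_S3 (hφ.continuous.comp continuous_subtype_val)
    refine ⟨hm.toLp _, ?_, ?_⟩
    · rw [mem_ofPred_eq, hU, inner_toLp_eq_integral, norm_toLp_eq_sqrt_integral]
      exact u.abs_integral_mul_le hφ hu
    · rw [dist_eq_norm]
      exact h.trans_lt (half_lt_self hε)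
  rw [real_inner_self_eq_norm_sq, abs_of_nonneg (sq_nonneg _), sq] at key
  have h2 : ‖U‖ ^ 2 ≤ K ^ 2 := by
    rcases (norm_nonneg U).eq_or_lt with h0 | h0
    · rw [← h0, zero_pow two_ne_zero]; exact sq_nonneg _
    · exact pow_le_pow_left₀ h0.le (le_of_mul_le_mul_right key h0) 2
  rw [hU, norm_toLp_eq_sqrt_integral, Real.sq_sqrt (integral_nonneg fun x => sq_nonneg _),
    mul_pow, Real.sq_sqrt hE] at h2
  exact h2

/-! ### The energy gap and positivity of the width -/

theorem W12.norm_map (u : W12) : ∀ᵐ x ∂volS3, ‖u.map x‖ = 1 := by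
  filter_upwards [u.2.2] with x hx
  exact norm_eq_of_mem_sphere ⟨_, hx⟩

theorem W12.integral_map_apply (u : W12) (i : Fin 3) :
    (∫ x, u.map x ∂volS3) i = ∫ x, u.map x i ∂volS3 :=
  ((EuclideanSpace.proj (𝕜 := ℝ) i : Euc 3 →L[ℝ] ℝ).integral_comp_comm
    (u.memLp_map.integrable (by norm_num))).symm

/-- The energy gap for sphere-valued maps of mean zero. -/
theorem W12.le_dirichletEnergy (u : W12) (hu : ∫ x, u.map x ∂volS3 = 0) :
    volS3.real univ / (3 * Real.pi ^ 2) ≤ dirichletEnergy u := by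
  have h : ∀ i, ∫ x : S3, u.map x i ^ 2 ∂volS3 ≤ Real.pi ^ 2 * dirichletEnergy u := fun i =>
    u.integral_coord_sq_le (by rw [← u.integral_map_apply, hu]; rfl)
  -- The squares of the three coordinates add up to `|u|² = 1`; summing the three Poincaré
  -- inequalities produces the factor `3`.
  have hsum : ∑ i, ∫ x : S3, u.map x i ^ 2 ∂volS3 = volS3.real univ := by
    rw [← integral_finsetSum _ fun i _ => (u.memLp_coord i).integrable_sq]
    have : (fun x => ∑ i, u.map x i ^ 2) =ᵐ[volS3] fun _ => (1 : ℝ) := by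
      filter_upwards [u.norm_map] with x hx
      rw [← EuclideanSpace.real_norm_sq_eq, hx, one_pow]
    rw [integral_congr_ae this]
    simp
  rw [div_le_iff₀ (by positivity), ← hsum, Fin.sum_univ_three]
  linarith [h 0, h 1, h 2]

/-- The energy is a finite sum of squared `L²` norms of bounded linear images of `du`. -/
theorem continuous_dirichletEnergy : Continuous dirichletEnergy := by
  have h : dirichletEnergy = fun u : W12 => ∑ i : Fin 4,
      ‖(ContinuousLinearMap.apply ℝ (Euc 3) (EuclideanSpace.single i (1 : ℝ))).compLpL 2 volS3
        u.1.2‖ ^ 2 := by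
    funext u
    rw [dirichletEnergy, integral_finsetSum]
    · refine Finset.sum_congr rfl fun i _ => ?_
      rw [← real_inner_self_eq_norm_sq, L2.inner_def]
      refine integral_congr_ae ?_
      filter_upwards [ContinuousLinearMap.coeFn_compLpL (𝕜' := ℝ)
        (ContinuousLinearMap.apply ℝ (Euc 3) (EuclideanSpace.single i (1 : ℝ))) u.1.2] with x hx
      rw [hx, real_inner_self_eq_norm_sq]
      rfl
    · intro i _
      exact ((ContinuousLinearMap.apply ℝ (Euc 3)
        (EuclideanSpace.single i (1 : ℝ))).comp_memLp' u.memLp_diff).norm.integrable_sq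
  rw [h]
  fun_prop

theorem exists_max_dirichletEnergy (u : C(ClosedB4, W12)) :
    ∃ a₀, ∀ a, dirichletEnergy (u a) ≤ dirichletEnergy (u a₀) := by
  have : CompactSpace ClosedB4 := isCompact_iff_compactSpace.mp (isCompact_closedBall _ _)
  have : Nonempty ClosedB4 := ⟨⟨0, by simp⟩⟩
  obtain ⟨a, -, ha⟩ := isCompact_univ.exists_isMaxOn univ_nonempty
    (continuous_dirichletEnergy.comp u.continuous).continuousOn
  exact ⟨a, fun b => ha (mem_univ b)⟩

theorem continuous_integral_map : Continuous fun u : W12 => ∫ x, u.map x ∂volS3 := by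
  have hc : ∀ i (u : W12), (∫ x, u.map x ∂volS3) i = inner ℝ
      ((memLp_const (μ := volS3) (p := 2) (EuclideanSpace.single i (1 : ℝ) : Euc 3)).toLp _)
      u.1.1 := by
    intro i u
    rw [u.integral_map_apply, L2.inner_def]
    refine integral_congr_ae ?_
    filter_upwards [(memLp_const (μ := volS3) (p := 2)
      (EuclideanSpace.single i (1 : ℝ) : Euc 3)).coeFn_toLp] with x hx
    rw [hx, EuclideanSpace.inner_single_left]
    simp [W12.map]
  have : Continuous fun u : W12 => WithLp.toLp 2 fun i => (∫ x, u.map x ∂volS3) i := by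
    simp only [hc]
    fun_prop
  exact this

/-- In every sweepout some map has mean zero. -/
theorem exists_integral_map_eq_zero {u : C(ClosedB4, W12)} (hu : u ∈ Sweep11) :
    ∃ a, ∫ x, (u a).map x ∂volS3 = 0 := by
  by_contra! hne
  obtain ⟨-, c, hc, hn⟩ := hu
  apply hn
  have hm : Continuous fun a => ∫ x, (u a).map x ∂volS3 := continuous_integral_map.comp u.continuous
  have hN : ∀ a, ‖∫ x, (u a).map x ∂volS3‖⁻¹ • ∫ x, (u a).map x ∂volS3 ∈ sphere (0 : Euc 3) 1 := by
    intro a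
    have := norm_ne_zero_iff.mpr (hne a)
    simp [norm_smul, this]
  -- The normalized mean, a map of the contractible ball to `S²` that restricts to `c` on the
  -- boundary.
  let N : C(ClosedB4, S2) := ⟨fun a => ⟨_, hN a⟩,
    ((hm.norm.inv₀ fun a => norm_ne_zero_iff.mpr (hne a)).smul hm).subtype_mk hN⟩
  have : ContractibleSpace ClosedB4 :=
    (convex_closedBall (0 : Euc 4) 1).contractibleSpace ⟨0, by simp⟩
  let b : C(S3, ClosedB4) := ⟨boundaryIncl, continuous_subtype_val.subtype_mk _⟩
  have hcN : c = N.comp b := by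
    ext1 a
    apply Subtype.ext
    have : ∫ x, (u (boundaryIncl a)).map x ∂volS3 = volS3.real univ • (c a : Euc 3) := by
      rw [integral_congr_ae (hc a), integral_const]
    change (c a : Euc 3) = ‖∫ x, (u (boundaryIncl a)).map x ∂volS3‖⁻¹ •
      ∫ x, (u (boundaryIncl a)).map x ∂volS3
    rw [this, norm_smul, norm_eq_of_mem_sphere, mul_one, smul_smul, Real.norm_eq_abs,
      abs_of_pos volS3_real_univ_pos, inv_mul_cancel₀ volS3_real_univ_pos.ne', one_smul]
  rw [hcN]
  exact ((id_nullhomotopic ClosedB4).comp_right N).comp_left b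

/-- Nonemptiness matters: the real infimum over an empty family is `0` by convention. The attained
maximum supplies the boundedness needed to compare a value with the supremum. -/
theorem width11_pos (h : Sweep11.Nonempty) : 0 < width11 := by
  have : Nonempty Sweep11 := h.to_subtype
  refine lt_of_lt_of_le (b := volS3.real univ / (3 * Real.pi ^ 2))
    (div_pos volS3_real_univ_pos (by positivity)) (le_ciInf fun u => ?_)
  obtain ⟨a₀, ha₀⟩ := exists_max_dirichletEnergy u.1
  obtain ⟨a, ha⟩ := exists_integral_map_eq_zero u.2
  exact ((u.1 a).le_dirichletEnergy ha).trans
    (le_ciSup (f := fun a => dirichletEnergy (u.1 a)) ⟨_, forall_mem_range.mpr ha₀⟩ a)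

/-! ### The no-retraction theorem -/

open Polynomial in
/-- The determinants `det (1 + M)` are fixed linear combinations of the `det (1 + t M)` for
finitely many `t` in a given interval. -/
theorem exists_det_one_add_eq_sum (E : Type*) [NormedAddCommGroup E] [NormedSpace ℝ E]
    [FiniteDimensional ℝ E] {δ : ℝ} (hδ : 0 < δ) :
    ∃ (s : Finset ℕ) (v ℓ : ℕ → ℝ), (∀ i ∈ s, v i ∈ Ioo 0 δ) ∧ ∑ i ∈ s, ℓ i = 1 ∧
      ∀ M : E →L[ℝ] E, (ContinuousLinearMap.id ℝ E + M).det =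
        ∑ i ∈ s, ℓ i * (ContinuousLinearMap.id ℝ E + v i • M).det := by
  classical
  let n := Module.finrank ℝ E
  -- Lagrange interpolation at `n + 1` distinct nodes in `(0, δ)`, evaluated at `1`: the polynomial
  -- `det (1 + t M)` has degree at most `n`.
  let v : ℕ → ℝ := fun i => δ / (i + 2)
  have hv : Function.Injective v := by
    intro i j h
    have hi : (0 : ℝ) < (i : ℝ) + 2 := by positivity
    have hj : (0 : ℝ) < (j : ℝ) + 2 := by positivity
    simp only [v] at h
    rw [div_eq_div_iff hi.ne' hj.ne', mul_right_inj' hδ.ne'] at h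
    have h' : (i : ℝ) = j := by linarith
    exact_mod_cast h'
  let s := Finset.range (n + 1)
  have hs : Set.InjOn v s := hv.injOn
  refine ⟨s, v, fun i => (Lagrange.basis s v i).eval 1, ?_, ?_, ?_⟩
  · intro i _
    have hi : (0 : ℝ) ≤ i := i.cast_nonneg
    refine ⟨by positivity, ?_⟩
    rw [div_lt_iff₀ (by positivity)]
    nlinarith
  · have := congrArg (eval 1) (Lagrange.sum_basis hs (by simp [s]))
    simpa [eval_finsetSum] using this
  · intro M
    let b := Module.finBasis ℝ E
    let A := LinearMap.toMatrix b b (M : E →ₗ[ℝ] E)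
    let P : ℝ[X] := ((X : ℝ[X]) • A.map C + (1 : Matrix _ _ ℝ).map C).det
    have hP : ∀ t : ℝ, P.eval t = (ContinuousLinearMap.id ℝ E + t • M).det := by
      intro t
      rw [ContinuousLinearMap.det, ← LinearMap.det_toMatrix b]
      simp only [P, ← coe_evalRingHom, RingHom.map_det]
      congr 1
      ext i j
      have h1 : eval t ((1 : Matrix _ _ ℝ).map C i j) = if i = j then 1 else 0 := by
        rw [Matrix.map_apply, eval_C, Matrix.one_apply]
      simp only [RingHom.mapMatrix_apply, Matrix.map_apply, Matrix.add_apply, coe_evalRingHom,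
        eval_add] at h1 ⊢
      rw [h1]
      have h2 : LinearMap.toMatrix b b
          ((ContinuousLinearMap.id ℝ E + t • M : E →L[ℝ] E) : E →ₗ[ℝ] E) i j =
          (if i = j then 1 else 0) + t * A i j := by
        simp [A, LinearMap.toMatrix_apply, Finsupp.single_apply, @eq_comm _ j i]
      rw [h2, add_comm, Matrix.smul_apply, Matrix.map_apply, smul_eq_mul, eval_mul, eval_X, eval_C]
    have hdeg : P.degree < s.card := by
      refine lt_of_le_of_lt degree_le_natDegree ?_
      have h1 : P.natDegree ≤ n := by
        simpa only [Fintype.card_fin] using natDegree_det_X_add_C_le A (1 : Matrix _ _ ℝ)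
      simp only [s, Finset.card_range]
      exact_mod_cast Nat.lt_succ_of_le h1
    have h := congrArg (eval 1) (Lagrange.eq_interpolate hs hdeg)
    rw [Lagrange.interpolate_apply, eval_finsetSum, hP, one_smul] at h
    rw [h]
    refine Finset.sum_congr rfl fun i _ => ?_
    rw [eval_mul, eval_C, hP, mul_comm]

section Retraction

variable {E : Type*} [NormedAddCommGroup E] [InnerProductSpace ℝ E]

/-- A segment leaving the ball crosses the sphere, where `h` vanishes; the Lipschitz bound up to
that point suffices. -/
theorem lipschitzWith_indicator_closedBall {R : ℝ} {h : E → E} {C : NNReal}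
    (hL : LipschitzOnWith C h (closedBall 0 R)) (h0 : ∀ x, ‖x‖ = R → h x = 0) :
    LipschitzWith C ((closedBall (0 : E) R).indicator h) := by
  have key : ∀ x y, x ∈ closedBall (0 : E) R → y ∉ closedBall (0 : E) R →
      dist (h x) 0 ≤ C * dist x y := by
    intro x y hx hy
    have hcont : ContinuousOn (fun t : ℝ => ‖AffineMap.lineMap x y t‖) (Icc 0 1) := by
      have : Continuous fun t : ℝ => (AffineMap.lineMap x y t : E) :=
        AffineMap.lineMap_continuous
      fun_prop
    simp only [mem_closedBall, dist_zero_right, not_le] at hx hy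
    obtain ⟨t, ht, htR⟩ := intermediate_value_Icc zero_le_one hcont
      (show R ∈ Icc _ _ by simpa using ⟨hx, hy.le⟩)
    simp only at htR
    have h1 := hL.dist_le_mul x (by simpa using hx) (AffineMap.lineMap x y t)
      (by simpa using htR.le)
    rw [h0 _ htR] at h1
    refine h1.trans (mul_le_mul_of_nonneg_left ?_ C.2)
    rw [dist_left_lineMap, Real.norm_eq_abs, abs_of_nonneg ht.1]
    exact mul_le_of_le_one_left dist_nonneg ht.2
  refine LipschitzWith.of_dist_le_mul fun x y => ?_
  by_cases hx : x ∈ closedBall (0 : E) R <;> by_cases hy : y ∈ closedBall (0 : E) R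
  · rw [indicator_of_mem hx, indicator_of_mem hy]
    exact hL.dist_le_mul x hx y hy
  · rw [indicator_of_mem hx, indicator_of_notMem hy]
    exact key x y hx hy
  · rw [indicator_of_notMem hx, indicator_of_mem hy, dist_comm, dist_comm x]
    exact key y x hy hx
  · rw [indicator_of_notMem hx, indicator_of_notMem hy, dist_self]
    positivity

variable [FiniteDimensional ℝ E]

/-- With `h` extended by zero, the map is the identity plus a contraction, hence a bijection of `E`.
It fixes every point outside the open ball, so it permutes the ball. -/
theorem image_ball_add_smul {R : ℝ} {h : E → E} {C : NNReal}
    (hL : LipschitzOnWith C h (closedBall 0 R)) (h0 : ∀ x, ‖x‖ = R → h x = 0) {t : ℝ}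
    (ht : 0 ≤ t) (htC : t * C < 1) :
    InjOn (fun x => x + t • h x) (ball 0 R) ∧ (fun x => x + t • h x) '' ball 0 R = ball 0 R := by
  set H := (closedBall (0 : E) R).indicator h
  have hH : LipschitzWith C H := lipschitzWith_indicator_closedBall hL h0
  let f : E → E := fun x => x + t • H x
  have hHb : ∀ x ∉ ball (0 : E) R, H x = 0 := by
    intro x hx
    by_cases hx' : x ∈ closedBall (0 : E) R
    · rw [show H x = h x from indicator_of_mem hx' h]
      simp only [mem_ball, mem_closedBall, dist_zero_right, not_lt] at hx hx'
      exact h0 x (le_antisymm hx' hx)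
    · exact indicator_of_notMem hx' _
  have hfb : ∀ x ∈ ball (0 : E) R, f x = x + t • h x := fun x hx => by
    simp only [f, H, indicator_of_mem (ball_subset_closedBall hx)]
  let tn : NNReal := ⟨t, ht⟩
  have hf : ApproximatesLinearOn f (ContinuousLinearEquiv.refl ℝ E : E →L[ℝ] E) univ (tn * C) := by
    rw [ApproximatesLinearOn.approximatesLinearOn_iff_lipschitzOnWith, lipschitzOnWith_univ]
    refine LipschitzWith.of_dist_le_mul fun x y => ?_
    have h1 := hH.dist_le_mul x y
    simp only [Pi.sub_apply, f, ContinuousLinearEquiv.coe_coe, ContinuousLinearEquiv.coe_refl',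
      id, add_sub_cancel_left, dist_smul₀, NNReal.coe_mul, Real.norm_eq_abs, abs_of_nonneg ht]
    rw [mul_assoc]
    exact mul_le_mul_of_nonneg_left h1 ht
  have hc : Subsingleton E ∨ tn * C <
      ‖((ContinuousLinearEquiv.refl ℝ E).symm : E →L[ℝ] E)‖₊⁻¹ := by
    rcases subsingleton_or_nontrivial E with hE | hE
    · exact Or.inl hE
    · right
      have : ‖((ContinuousLinearEquiv.refl ℝ E).symm : E →L[ℝ] E)‖₊ = 1 := by
        ext
        exact ContinuousLinearMap.norm_id
      rw [this, inv_one]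
      exact_mod_cast htC
  have hinj : Function.Injective f :=
    injOn_univ.mp (hf.injOn hc)
  have hsurj : Function.Surjective f := hf.surjective hc
  have hfix : ∀ x ∉ ball (0 : E) R, f x = x := fun x hx => by simp [f, hHb x hx]
  refine ⟨fun x hx y hy hxy => hinj ?_, ?_⟩
  · rw [hfb x hx, hfb y hy]
    exact hxy
  · rw [← image_congr hfb]
    ext y
    constructor
    · rintro ⟨x, hx, rfl⟩
      by_contra hy
      exact hy (by rwa [hinj (hfix _ hy)])
    · intro hy
      obtain ⟨x, rfl⟩ := hsurj y
      refine ⟨x, ?_, rfl⟩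
      by_contra hx
      exact hx (by rwa [hfix x hx] at hy)

variable [MeasurableSpace E] [BorelSpace E]

/-- There is no smooth retraction of a ball onto its boundary sphere. -/
theorem no_contDiff_retraction [Nontrivial E] {R : ℝ} (hR : 0 < R) {q : E → E}
    (hq : ContDiff ℝ 1 q) (hqR : ∀ x, ‖q x‖ = R) (hqx : ∀ x, ‖x‖ = R → q x = x) : False := by
  let h : E → E := fun x => q x - x
  have hh : ContDiff ℝ 1 h := hq.sub contDiff_id
  have hd : ∀ x, HasFDerivAt h (fderiv ℝ h x) x :=
    fun x => (hh.differentiable (by norm_num) x).hasFDerivAt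
  have hdc : Continuous (fderiv ℝ h) := hh.continuous_fderiv (by norm_num)
  obtain ⟨C, hC⟩ := (((isCompact_closedBall (0 : E) R).image hdc).isBounded).exists_norm_le
  have hC0 : 0 ≤ C := (norm_nonneg _).trans (hC _ ⟨0, by simp [hR.le], rfl⟩)
  let Cn : NNReal := ⟨C, hC0⟩
  have hL : LipschitzOnWith Cn h (closedBall 0 R) :=
    (convex_closedBall 0 R).lipschitzOnWith_of_nnnorm_hasFDerivWithin_le
      (fun x _ => (hd x).hasFDerivWithinAt) fun x hx => hC _ ⟨x, hx, rfl⟩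
  have h0 : ∀ x, ‖x‖ = R → h x = 0 := fun x hx => by simp [h, hqx x hx]
  have hdet : ContinuousAt (fun A : E →L[ℝ] E => A.det) (ContinuousLinearMap.id ℝ E) :=
    ContinuousLinearMap.continuous_det.continuousAt
  have hpos : ∀ᶠ A : E →L[ℝ] E in nhds (ContinuousLinearMap.id ℝ E), 0 < A.det := by
    refine hdet.eventually (lt_mem_nhds ?_)
    simp [ContinuousLinearMap.det]
  obtain ⟨ε, hε, hpos⟩ := Metric.eventually_nhds_iff.mp hpos
  -- For `t < δ`, `t C < 1` makes `x + t h(x)` bijective, and `t C < ε` keeps its Jacobian positive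
  -- on the ball.
  let δ := min 1 ε / (C + 1)
  have hδ : 0 < δ := by positivity
  obtain ⟨s, v, ℓ, hv, hℓ, hsum⟩ := exists_det_one_add_eq_sum E hδ
  have hvC : ∀ i ∈ s, v i * C < min 1 ε := by
    intro i hi
    have h1 := (hv i hi).2
    rw [lt_div_iff₀ (by positivity)] at h1
    nlinarith [(hv i hi).1]
  let vol : Measure E := volume
  have hdt : ∀ (t : ℝ) x, HasFDerivAt (fun x => x + t • h x)
      (ContinuousLinearMap.id ℝ E + t • fderiv ℝ h x) x := fun t x => by
    have := HasFDerivAt.add (hasFDerivAt_id x) ((hd x).const_smul t)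
    exact this
  -- Change of variables: for small `t` the Jacobian integrates to the volume of the ball.
  have hvol : ∀ i ∈ s, ∫ x in ball (0 : E) R,
      (ContinuousLinearMap.id ℝ E + v i • fderiv ℝ h x).det = vol.real (ball 0 R) := by
    intro i hi
    have htC : v i * C < 1 := (hvC i hi).trans_le (min_le_left _ _)
    obtain ⟨hinj, himg⟩ := image_ball_add_smul hL h0 (hv i hi).1.le htC
    have h1 := integral_image_eq_integral_abs_det_fderiv_smul volume measurableSet_ball
      (fun x _ => (hdt (v i) x).hasFDerivWithinAt) hinj (fun _ => (1 : ℝ))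
    rw [himg] at h1
    simp only [smul_eq_mul, mul_one, integral_const, measureReal_restrict_apply_univ] at h1
    rw [show vol.real (ball 0 R) = _ from h1]
    refine setIntegral_congr_fun measurableSet_ball fun x hx => ?_
    refine (abs_of_pos (hpos ?_)).symm
    rw [dist_eq_norm, add_sub_cancel_left, norm_smul, Real.norm_eq_abs, abs_of_pos (hv i hi).1]
    refine lt_of_le_of_lt ?_ ((hvC i hi).trans_le (min_le_right _ _))
    exact mul_le_mul_of_nonneg_left (hC _ ⟨x, ball_subset_closedBall hx, rfl⟩) (hv i hi).1.le
  -- As `‖q‖` is constant, the range of `Dq` is orthogonal to `q x ≠ 0`, so `Dq` is singular.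
  have hq0 : ∀ x, (ContinuousLinearMap.id ℝ E + fderiv ℝ h x).det = 0 := by
    intro x
    have hqd : HasFDerivAt q (ContinuousLinearMap.id ℝ E + fderiv ℝ h x) x := by
      have := hdt 1 x
      simpa [h] using this
    set L := ContinuousLinearMap.id ℝ E + fderiv ℝ h x
    by_contra hne
    have hort : ∀ w, inner ℝ (q x) (L w) = 0 := by
      intro w
      have h1 := (hqd.norm_sq).unique
        ((hasFDerivAt_const (R ^ 2) x).congr_of_eventuallyEq
          (Filter.Eventually.of_forall fun y => by simp [hqR]))
      have h2 := congrArg (fun A : E →L[ℝ] ℝ => A w) h1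
      simpa using h2
    obtain ⟨w, hw⟩ := (LinearMap.equivOfDetNeZero (L : E →ₗ[ℝ] E) hne).surjective (q x)
    have h1 := hort w
    have h2 : L w = q x := hw
    rw [h2, inner_self_eq_zero, ← norm_eq_zero, hqR] at h1
    exact hR.ne' h1
  have hint : ∀ i ∈ s, IntegrableOn (fun x : E =>
      ℓ i * (ContinuousLinearMap.id ℝ E + v i • fderiv ℝ h x).det) (ball 0 R) := by
    intro i _
    have hc : Continuous fun x : E =>
        ℓ i * (ContinuousLinearMap.id ℝ E + v i • fderiv ℝ h x).det :=
      continuous_const.mul (ContinuousLinearMap.continuous_det.comp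
        (continuous_const.add (hdc.const_smul (v i))))
    exact (hc.continuousOn.integrableOn_compact (isCompact_closedBall 0 R)).mono_set
      ball_subset_closedBall
  -- Interpolation carries the volume identity from small `t` to `t = 1`, where the determinant
  -- vanishes.
  have h1 : ∫ x in ball (0 : E) R, (ContinuousLinearMap.id ℝ E + fderiv ℝ h x).det =
      vol.real (ball 0 R) := by
    rw [integral_congr_ae (Filter.Eventually.of_forall fun x => hsum (fderiv ℝ h x)),
      integral_finsetSum _ hint]
    simp only [integral_const_mul]
    rw [Finset.sum_congr rfl fun i hi => by rw [hvol i hi], ← Finset.sum_mul, hℓ, one_mul]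
  simp only [hq0, integral_zero] at h1
  have h2 : 0 < vol.real (ball 0 R) := by
    rw [measureReal_def]
    exact ENNReal.toReal_pos (measure_ball_pos vol _ hR).ne' measure_ball_lt_top.ne
  exact h2.ne h1

/-- There is no continuous map of the space to the unit sphere which is the radial projection
outside the unit ball. -/
theorem no_continuous_retraction [Nontrivial E] {r : E → E} (hr : Continuous r)
    (hr1 : ∀ x, ‖r x‖ = 1) (hrx : ∀ x, 1 ≤ ‖x‖ → r x = ‖x‖⁻¹ • x) : False := by
  have hS : IsClosed {x : E | 2 ≤ ‖x‖} := isClosed_le continuous_const continuous_norm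
  have hU : {x : E | 1 < ‖x‖} ∈ nhdsSet {x : E | 2 ≤ ‖x‖} := by
    refine (isOpen_lt continuous_const continuous_norm).mem_nhdsSet.mpr fun x hx => ?_
    exact lt_of_lt_of_le one_lt_two (show 2 ≤ ‖x‖ from hx)
  have hrU : ContDiffOn ℝ (⊤ : ℕ∞) r {x : E | 1 < ‖x‖} := by
    have : ContDiffOn ℝ (⊤ : ℕ∞) (fun x : E => ‖x‖⁻¹ • x) {x : E | 1 < ‖x‖} := by
      intro x hx
      have hx0 : x ≠ 0 := norm_pos_iff.mp (zero_lt_one.trans hx)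
      exact (((contDiffAt_norm ℝ hx0).inv (norm_ne_zero_iff.mpr hx0)).smul
        contDiffAt_id).contDiffWithinAt
    exact this.congr fun x hx => hrx x (le_of_lt hx)
  -- Smoothing within distance `1` keeps `g` away from zero. It leaves `r` untouched for `‖x‖ ≥ 2`,
  -- hence the radius `2` below.
  obtain ⟨g, hg, hgr, hgS, -⟩ := hr.exists_contDiff_approx_and_eqOn ⊤ continuous_const
    (ε := fun _ => 1) (fun _ => one_pos) hS hU hrU
  have hg0 : ∀ x, g x ≠ 0 := by
    intro x h
    have := hgr x
    rw [h, dist_zero_left, hr1] at this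
    exact lt_irrefl _ this
  refine no_contDiff_retraction (R := 2) two_pos (q := fun x => (2 * ‖g x‖⁻¹) • g x) ?_ ?_ ?_
  · have hg1 : ContDiff ℝ 1 g := hg.of_le (by exact_mod_cast le_top)
    exact (contDiff_const.mul ((hg1.norm ℝ hg0).inv fun x => norm_ne_zero_iff.mpr (hg0 x))).smul hg1
  · intro x
    have := norm_ne_zero_iff.mpr (hg0 x)
    rw [norm_smul, norm_mul, norm_inv, norm_norm, mul_assoc, inv_mul_cancel₀ this, mul_one,
      Real.norm_eq_abs, abs_two]
  · intro x hx
    have h1 : g x = r x := hgS (show 2 ≤ ‖x‖ from hx.ge)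
    simp only [h1]
    rw [hr1, hrx x (by rw [hx]; norm_num), hx, inv_one, smul_smul]
    norm_num

end Retraction

/-! ### The Hopf map is essential -/

/-- The Hopf map `x ↦ x i x̄`, as a quadratic map of `ℝ⁴` to `ℝ³`. -/
def hopf (x : Euc 4) : Euc 3 :=
  !₂[x 0 ^ 2 + x 1 ^ 2 - x 2 ^ 2 - x 3 ^ 2, 2 * (x 1 * x 2 + x 0 * x 3),
     2 * (x 1 * x 3 - x 0 * x 2)]

theorem norm_sq_euc3 (x : Euc 3) : ‖x‖ ^ 2 = x 0 ^ 2 + x 1 ^ 2 + x 2 ^ 2 := by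
  simp [EuclideanSpace.norm_sq_eq, Fin.sum_univ_three]

theorem norm_hopf (x : Euc 4) : ‖hopf x‖ = ‖x‖ ^ 2 := by
  rw [← pow_left_inj₀ (norm_nonneg _) (sq_nonneg _) two_ne_zero, norm_sq_euc3, norm_sq_euc4]
  simp [hopf]
  ring

theorem contDiff_hopf : ContDiff ℝ ∞ hopf := by
  have h : ∀ i, ContDiff ℝ ∞ fun x : Euc 4 => x i := fun i =>
    (EuclideanSpace.proj (𝕜 := ℝ) i : Euc 4 →L[ℝ] ℝ).contDiff
  rw [contDiff_euclidean]
  intro i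
  fin_cases i <;> simp [hopf] <;> fun_prop

theorem hopf_mem_sphere (x : S3) : hopf x ∈ sphere (0 : Euc 3) 1 := by simp [norm_hopf]

/-- The Hopf map of `S³` to `S²`. -/
def hopfMap : C(S3, S2) :=
  ⟨fun x => ⟨hopf x, hopf_mem_sphere x⟩,
    (contDiff_hopf.continuous.comp continuous_subtype_val).subtype_mk hopf_mem_sphere⟩

/-- Up to normalization, the point over `q` obtained from `x` by rotating `hopf x` to `q`. -/
def preTransport (x : Euc 4) (q : Euc 3) : Euc 4 :=
  x - qmul !₂[0, q 0, q 1, q 2] (qmul x (qunit 0))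

theorem preTransport_eq (x : Euc 4) (q : Euc 3) : preTransport x q =
    !₂[x 0 + q 0 * x 0 + q 1 * x 3 - q 2 * x 2, x 1 + q 0 * x 1 + q 1 * x 2 + q 2 * x 3,
       x 2 - q 0 * x 2 + q 1 * x 1 - q 2 * x 0, x 3 - q 0 * x 3 + q 1 * x 0 + q 2 * x 1] := by
  ext i
  fin_cases i <;> simp [preTransport, qmul, qunit] <;> ring

/-- For `w = x - q x i`, `q² = -1` gives `w i = q w`, hence `w i w̄ = |w|² q`. The equations
`h0`–`h3` are the components of `w i = q w`. -/
theorem hopf_preTransport (x : Euc 4) (q : S2) :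
    hopf (preTransport x q) = ‖preTransport x q‖ ^ 2 • (q : Euc 3) := by
  have hq : (q : Euc 3) 0 ^ 2 + (q : Euc 3) 1 ^ 2 + (q : Euc 3) 2 ^ 2 = 1 := by
    rw [← norm_sq_euc3, norm_eq_of_mem_sphere, one_pow]
  set a := (q : Euc 3) 0
  set b := (q : Euc 3) 1
  set c := (q : Euc 3) 2
  obtain ⟨h0, h1, h2, h3⟩ :
      -(preTransport x q 1) = -(a * preTransport x q 1) - b * preTransport x q 2
        - c * preTransport x q 3 ∧
      preTransport x q 0 = a * preTransport x q 0 + b * preTransport x q 3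
        - c * preTransport x q 2 ∧
      preTransport x q 3 = -(a * preTransport x q 3) + b * preTransport x q 0
        + c * preTransport x q 1 ∧
      -(preTransport x q 2) = a * preTransport x q 2 - b * preTransport x q 1
        + c * preTransport x q 0 := by
    rw [preTransport_eq]
    simp
    refine ⟨?_, ?_, ?_, ?_⟩
    · linear_combination x 1 * hq
    · linear_combination (-(x 0)) * hq
    · linear_combination (-(x 3)) * hq
    · linear_combination x 2 * hq
  rw [norm_sq_euc4]
  generalize preTransport x q = w at *
  ext i
  fin_cases i <;> simp [hopf]
  · linear_combination (-(w 1)) * h0 + w 0 * h1 - w 3 * h2 + w 2 * h3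
  · linear_combination (-(w 2)) * h0 + w 3 * h1 + w 0 * h2 - w 1 * h3
  · linear_combination (-(w 3)) * h0 - w 2 * h1 + w 1 * h2 + w 0 * h3

/-- Multiplying `x - q x i` on the right by the unit quaternion `i x̄` gives `x i x̄ + q`. Thus the
transport degenerates only at the antipode `q = -hopf x`. -/
theorem norm_preTransport (x : S3) (q : S2) :
    ‖preTransport x q‖ = ‖hopf x + (q : Euc 3)‖ := by
  have hx := sum_sq_S3 x
  have hh := norm_hopf x
  rw [norm_S3, one_pow] at hh
  have hh2 : ‖hopf x‖ ^ 2 = 1 := by rw [hh, one_pow]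
  rw [norm_sq_euc3] at hh2
  rw [← pow_left_inj₀ (norm_nonneg _) (norm_nonneg _) two_ne_zero, norm_sq_euc3, norm_sq_euc4,
    preTransport_eq]
  simp [hopf] at hh2 ⊢
  linear_combination (1 + (q : Euc 3) 0 ^ 2 + (q : Euc 3) 1 ^ 2 + (q : Euc 3) 2 ^ 2) * hx - hh2

theorem preTransport_hopf (x : S3) : preTransport x (hopf x) = (2 : ℝ) • (x : Euc 4) := by
  have hx := sum_sq_S3 x
  rw [preTransport_eq]
  ext i
  fin_cases i <;> simp [hopf]
  · linear_combination (x : Euc 4) 0 * hx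
  · linear_combination (x : Euc 4) 1 * hx
  · linear_combination (x : Euc 4) 2 * hx
  · linear_combination (x : Euc 4) 3 * hx

theorem hopf_smul (r : ℝ) (x : Euc 4) : hopf (r • x) = r ^ 2 • hopf x := by
  ext i
  fin_cases i <;> simp [hopf] <;> ring

theorem continuous_preTransport : Continuous fun p : Euc 4 × Euc 3 => preTransport p.1 p.2 := by
  simp only [preTransport_eq]
  refine (PiLp.continuous_toLp 2 _).comp (continuous_pi fun i => ?_)
  fin_cases i <;> simp <;> fun_prop

theorem preTransport_ne_zero {x : S3} {q : S2} (h : dist (hopfMap x) q < 2) :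
    preTransport x q ≠ 0 := by
  rw [← norm_ne_zero_iff, norm_preTransport]
  intro h0
  rw [norm_eq_zero] at h0
  have : (hopfMap x : Euc 3) = -q := eq_neg_of_add_eq_zero_left h0
  rw [Subtype.dist_eq, this, dist_eq_norm, ← neg_add', norm_neg, ← two_smul ℝ, norm_smul,
    norm_eq_of_mem_sphere] at h
  norm_num at h

theorem normalize_mem_sphere {n : ℕ} {v : Euc n} (hv : v ≠ 0) :
    ‖v‖⁻¹ • v ∈ sphere (0 : Euc n) 1 := by
  have := norm_ne_zero_iff.mpr hv
  simp [norm_smul, this]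

/-- A homotopy moving points by less than the diameter lifts through the Hopf map. -/
theorem exists_lift_hopfMap_of_dist_lt {G : C(S3, S3)} {f : C(S3, S2)}
    (F : (hopfMap.comp G).Homotopy f) (hF : ∀ t x, dist (hopfMap (G x)) (F (t, x)) < 2) :
    ∃ G' : C(S3, S3), G.Homotopic G' ∧ hopfMap.comp G' = f := by
  have hne : ∀ z : unitInterval × S3, preTransport (G z.2) (F z) ≠ 0 := fun z =>
    preTransport_ne_zero (hF z.1 z.2)
  have hc : Continuous fun z : unitInterval × S3 => preTransport (G z.2) (F z) :=
    continuous_preTransport.comp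
      ((continuous_subtype_val.comp (G.continuous.comp continuous_snd)).prodMk
        (continuous_subtype_val.comp F.continuous))
  let H : C(unitInterval × S3, S3) := ⟨fun z => ⟨_, normalize_mem_sphere (hne z)⟩,
    ((hc.norm.inv₀ fun z => norm_ne_zero_iff.mpr (hne z)).smul hc).subtype_mk _⟩
  have hH : ∀ z, hopfMap (H z) = F z := by
    intro z
    apply Subtype.ext
    change hopf (‖preTransport (G z.2) (F z)‖⁻¹ • preTransport (G z.2) (F z)) = _
    rw [hopf_smul, hopf_preTransport, smul_smul, ← mul_pow,
      inv_mul_cancel₀ (norm_ne_zero_iff.mpr (hne z)), one_pow, one_smul]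
  refine ⟨⟨fun x => H (1, x), by fun_prop⟩, ⟨⟨H, fun x => ?_, fun x => rfl⟩⟩, ?_⟩
  · apply Subtype.ext
    have h0 : (F (0, x) : Euc 3) = hopf (G x) := by
      rw [F.apply_zero]; rfl
    change ‖preTransport (G x) (F (0, x))‖⁻¹ • preTransport (G x) (F (0, x)) = _
    rw [h0, preTransport_hopf, norm_smul, norm_S3, smul_smul]
    norm_num
  · ext1 x
    change hopfMap (H (1, x)) = f x
    rw [hH, F.apply_one]

/-- Homotopies of `hopfMap` lift, up to homotopy, to deformations of the identity of `S³`. -/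
theorem exists_lift_hopfMap {f : C(S3, S2)} (h : hopfMap.Homotopic f) :
    ∃ G : C(S3, S3), (ContinuousMap.id S3).Homotopic G ∧ hopfMap.comp G = f := by
  obtain ⟨F⟩ := h
  have huc : UniformContinuous F := CompactSpace.uniformContinuous_of_continuous F.continuous
  -- Time is cut into `n + 1` steps during which no point moves by `2`, the distance between
  -- antipodes; the lift is built step by step.
  obtain ⟨δ, hδ, hF⟩ := Metric.uniformContinuous_iff.mp huc 2 two_pos
  obtain ⟨n, hn⟩ := exists_nat_one_div_lt hδ
  let τ : ℝ → unitInterval := projIcc 0 1 zero_le_one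
  have hτc : Continuous τ := continuous_projIcc
  have key : ∀ k : ℕ, ∃ G : C(S3, S3), (ContinuousMap.id S3).Homotopic G ∧
      ∀ x, hopfMap (G x) = F (τ (k / (n + 1)), x) := by
    intro k
    induction k with
    | zero =>
      refine ⟨ContinuousMap.id S3, ContinuousMap.Homotopic.refl _, fun x => ?_⟩
      have : τ ((0 : ℕ) / (n + 1)) = 0 := by simp [τ]
      rw [this, F.apply_zero]
      rfl
    | succ k ih =>
      obtain ⟨G, hG, hGF⟩ := ih
      let g : C(S3, S2) := ⟨fun x => F (τ ((k + 1 : ℕ) / (n + 1)), x), by fun_prop⟩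
      let F' : (hopfMap.comp G).Homotopy g :=
        { toFun := fun z => F (τ ((k + z.1) / (n + 1)), z.2)
          continuous_toFun := by fun_prop
          map_zero_left := fun x => by simp [hGF]
          map_one_left := fun x => by simp [g] }
      obtain ⟨G', h1, h2⟩ := exists_lift_hopfMap_of_dist_lt F' fun t x => by
        rw [hGF]
        refine hF (lt_of_le_of_lt ?_ hn)
        rw [Prod.dist_eq, dist_self, max_eq_left dist_nonneg]
        refine (Subtype.dist_eq _ _).trans_le ?_
        refine (abs_projIcc_sub_projIcc zero_le_one).trans ?_
        rw [← sub_div, abs_div, abs_of_pos (by positivity : (0 : ℝ) < n + 1)]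
        refine div_le_div_of_nonneg_right ?_ (by positivity)
        rw [sub_add_cancel_left, abs_neg, abs_of_nonneg t.2.1]
        exact t.2.2
      exact ⟨G', hG.trans h1, fun x => congrArg (fun φ : C(S3, S2) => φ x) h2⟩
  obtain ⟨G, hG, hGF⟩ := key (n + 1)
  refine ⟨G, hG, ?_⟩
  ext1 x
  have h1 : τ ((n + 1 : ℕ) / (n + 1)) = 1 := by
    have : ((n + 1 : ℕ) : ℝ) / (n + 1) = 1 := by
      push_cast
      exact div_self (by positivity)
    rw [this]
    simp [τ]
  rw [ContinuousMap.comp_apply, hGF, h1, F.apply_one]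

/-- The segment from `G x` to `-z` avoids the origin unless `G x = z`, so it projects radially to
the sphere. -/
theorem nullhomotopic_of_forall_ne {G : C(S3, S3)} {z : S3} (h : ∀ x, G x ≠ z) :
    G.Nullhomotopic := by
  let w : unitInterval × S3 → Euc 4 := fun p =>
    (1 - (p.1 : ℝ)) • (G p.2 : Euc 4) - (p.1 : ℝ) • (z : Euc 4)
  have hw : ∀ p, w p ≠ 0 := by
    intro p hp
    have h1 : (1 - (p.1 : ℝ)) • (G p.2 : Euc 4) = (p.1 : ℝ) • (z : Euc 4) := sub_eq_zero.mp hp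
    have h2 := congrArg norm h1
    rw [norm_smul, norm_smul, norm_S3, norm_S3, Real.norm_eq_abs, Real.norm_eq_abs,
      abs_of_nonneg (sub_nonneg.mpr p.1.2.2), abs_of_nonneg p.1.2.1, mul_one, mul_one] at h2
    rw [h2] at h1
    have h3 : (p.1 : ℝ) ≠ 0 := by
      intro h0
      rw [h0] at h2
      norm_num at h2
    exact h p.2 (Subtype.ext (smul_right_injective _ h3 h1))
  have hwc : Continuous w := by fun_prop
  refine ⟨-z, ⟨⟨⟨fun p => ⟨_, normalize_mem_sphere (hw p)⟩,
    ((hwc.norm.inv₀ fun p => norm_ne_zero_iff.mpr (hw p)).smul hwc).subtype_mk _⟩,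
    fun x => ?_, fun x => ?_⟩⟩⟩
  · apply Subtype.ext
    simp [w]
  · apply Subtype.ext
    simp [w]

/-- The sphere `S³` is not contractible. -/
theorem not_nullhomotopic_id_S3 : ¬ (ContinuousMap.id S3).Nullhomotopic := by
  rintro ⟨c, ⟨H⟩⟩
  -- The homotopy is run inwards along radii: time `0` outside the unit ball, time `1` for `‖x‖ ≤
  -- 1/2`. There the value is `c`, so the arbitrary direction `e 0` does no harm.
  let s : Euc 4 → unitInterval := fun x => projIcc 0 1 zero_le_one (2 * (1 - ‖x‖))
  have hs : Continuous s := continuous_projIcc.comp (by fun_prop)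
  let e : Euc 4 → S3 := fun x => if h : x = 0 then c else ⟨_, normalize_mem_sphere h⟩
  have he : ∀ x ≠ 0, ContinuousAt e x := by
    intro x hx
    rw [Topology.IsInducing.subtypeVal.continuousAt_iff]
    have h1 : ContinuousAt (fun y : Euc 4 => ‖y‖⁻¹ • y) x :=
      (continuousAt_id.norm.inv₀ (norm_ne_zero_iff.mpr hx)).smul continuousAt_id
    refine h1.congr ?_
    filter_upwards [isOpen_ne.mem_nhds hx] with y hy
    simp [e, show y ≠ 0 from hy]
  let r : Euc 4 → Euc 4 := fun x => H (s x, e x)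
  refine no_continuous_retraction (r := r) ?_ (fun x => norm_S3 _) fun x hx => ?_
  · rw [continuous_iff_continuousAt]
    intro x
    by_cases hx : x = 0
    · have : r =ᶠ[nhds x] fun _ => (c : Euc 4) := by
        have hb : ball (0 : Euc 4) (1 / 2) ∈ nhds x := by
          rw [hx]
          exact ball_mem_nhds _ (by norm_num)
        filter_upwards [hb] with y hy
        have hy' : ‖y‖ < 1 / 2 := by simpa using hy
        have : s y = 1 := projIcc_of_right_le _ (by linarith)
        simp [r, this]
      exact this.continuousAt
    · exact continuous_subtype_val.continuousAt.comp
        (H.continuous.continuousAt.comp (hs.continuousAt.prodMk (he x hx)))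
  · have hx0 : x ≠ 0 := norm_pos_iff.mp (zero_lt_one.trans_le hx)
    have : s x = 0 := projIcc_of_le_left _ (by linarith)
    simp [r, this, e, hx0]

/-- A nullhomotopy lifts to one from the identity to a map `G` into a single fibre; `G` misses a
point, so the identity would be nullhomotopic. -/
theorem not_nullhomotopic_hopfMap : ¬ hopfMap.Nullhomotopic := by
  rintro ⟨y, h⟩
  obtain ⟨G, hG, hGy⟩ := exists_lift_hopfMap h
  obtain ⟨z, hz⟩ : ∃ z : S3, hopfMap z ≠ y := by
    by_contra! hall
    have h0 := (hall ⟨EuclideanSpace.single 0 1, by simp⟩).trans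
      (hall ⟨EuclideanSpace.single 2 1, by simp⟩).symm
    have h1 := congrArg (fun q : S2 => (q : Euc 3) 0) h0
    simp [hopfMap, hopf] at h1
    norm_num at h1
  have hGz : ∀ x, G x ≠ z := by
    intro x hx
    apply hz
    rw [← hx]
    exact congrArg (fun φ : C(S3, S2) => φ x) hGy
  obtain ⟨c, hc⟩ := nullhomotopic_of_forall_ne hGz
  exact not_nullhomotopic_id_S3 ⟨c, hG.trans hc⟩

/-! ### Integrals of the conformal factor -/

theorem sum_inner_qmul_sq (a : Euc 4) (x : S3) :
    ∑ j, inner ℝ a (qmul (qunit j) x) ^ 2 = ‖a‖ ^ 2 - inner ℝ a (x : Euc 4) ^ 2 := by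
  obtain ⟨h0, h1, h2⟩ := qmul_qunit x
  have hx := sum_sq_S3 x
  rw [Fin.sum_univ_three, h0, h1, h2, norm_sq_euc4]
  simp only [inner_euc4]
  simp
  linear_combination (a 0 ^ 2 + a 1 ^ 2 + a 2 ^ 2 + a 3 ^ 2) * hx

theorem norm_add_sq_S3 (a : Euc 4) (x : S3) :
    ‖(x : Euc 4) + a‖ ^ 2 = 1 + ‖a‖ ^ 2 + 2 * inner ℝ a (x : Euc 4) := by
  rw [norm_add_sq_real, norm_S3, real_inner_comm]
  ring

theorem add_ne_zero_of_norm_lt {a : Euc 4} (ha : ‖a‖ < 1) (x : S3) : (x : Euc 4) + a ≠ 0 := by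
  intro h
  have := norm_S3 x
  rw [eq_neg_of_add_eq_zero_left h, norm_neg] at this
  exact ha.ne this

/-- The divergence theorem on `S³` for zonal fields with axis `a`. -/
theorem integral_zonal {a : Euc 4} (ha : ‖a‖ < 1) {F F' : ℝ → ℝ}
    (hF : ∀ q, 0 < q → ContDiffAt ℝ 1 F q) (hF' : ∀ q, 0 < q → HasDerivAt F (F' q) q) :
    ∫ x : S3, (2 * F' (‖(x : Euc 4) + a‖ ^ 2) * (‖a‖ ^ 2 - inner ℝ a (x : Euc 4) ^ 2)
      - 3 * F (‖(x : Euc 4) + a‖ ^ 2) * inner ℝ a (x : Euc 4)) ∂volS3 = 0 := by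
  -- An affine function agreeing with `‖x + a‖²` on the sphere. The field is `F(Q)` times the
  -- tangential part of `a`, and `g j` are its frame components.
  let Q : Euc 4 → ℝ := fun y => 1 + ‖a‖ ^ 2 + 2 * inner ℝ a y
  have hQ : ∀ x : S3, ‖(x : Euc 4) + a‖ ^ 2 = Q x := norm_add_sq_S3 a
  have hQ0 : ∀ x : S3, 0 < Q x := fun x => by
    rw [← hQ]
    have := norm_pos_iff.mpr (add_ne_zero_of_norm_lt ha x)
    positivity
  have hQd : ∀ y, HasFDerivAt Q ((2 : ℝ) • innerSL ℝ a) y := fun y =>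
    ((innerSL ℝ a).hasFDerivAt.const_mul 2).const_add _
  have hQc : ContDiff ℝ 1 Q :=
    contDiff_const.add (contDiff_const.mul (contDiff_const.inner ℝ contDiff_id))
  let A : Fin 3 → Euc 4 →L[ℝ] Euc 4 := fun j => (qmulLeft (qunit j)).toContinuousLinearEquiv
  have hA : ∀ j y, A j y = qmul (qunit j) y := fun j y => rfl
  let g : Fin 3 → Euc 4 → ℝ := fun j y => F (Q y) * innerSL ℝ a (A j y)
  have hgc : ∀ j (x : S3), ContDiffAt ℝ 1 (g j) x := fun j x =>
    ((hF _ (hQ0 x)).comp (x : Euc 4) hQc.contDiffAt).mul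
      ((innerSL ℝ a).contDiff.comp (A j).contDiff).contDiffAt
  have hgd : ∀ j (x : S3), fderiv ℝ (g j) x (qmul (qunit j) x) =
      2 * F' (Q x) * inner ℝ a (qmul (qunit j) x) ^ 2 - F (Q x) * inner ℝ a (x : Euc 4) := by
    intro j x
    have h1 : HasFDerivAt (fun y => F (Q y)) (F' (Q x) • (2 : ℝ) • innerSL ℝ a) (x : Euc 4) :=
      (hF' _ (hQ0 x)).comp_hasFDerivAt (x : Euc 4) (hQd x)
    have h2 : HasFDerivAt (fun y => innerSL ℝ a (A j y)) ((innerSL ℝ a).comp (A j)) (x : Euc 4) :=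
      ((innerSL ℝ a).comp (A j)).hasFDerivAt
    have h3 : fderiv ℝ (g j) x = _ := (h1.mul h2).fderiv
    rw [h3]
    simp only [add_apply, smul_apply,
      ContinuousLinearMap.comp_apply, hA, qmul_qmul_self (qunit_zero j), innerSL_apply_apply,
      inner_neg_right, smul_eq_mul]
    ring
  have hsum : ∀ x : S3, 2 * F' (‖(x : Euc 4) + a‖ ^ 2) * (‖a‖ ^ 2 - inner ℝ a (x : Euc 4) ^ 2)
      - 3 * F (‖(x : Euc 4) + a‖ ^ 2) * inner ℝ a (x : Euc 4) =
      ∑ j, fderiv ℝ (g j) x (qmul (qunit j) x) := by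
    intro x
    simp only [hgd, hQ]
    rw [Finset.sum_sub_distrib, ← Finset.mul_sum, sum_inner_qmul_sq]
    simp
    ring
  simp only [hsum]
  have hi : ∀ j, Integrable (fun x : S3 => fderiv ℝ (g j) x (qmul (qunit j) x)) volS3 := fun j =>
    integrable_S3 ((continuous_fderiv_S3 (hgc j)).clm_apply
      ((A j).continuous.comp continuous_subtype_val))
  rw [integral_finsetSum _ fun j _ => hi j]
  exact Finset.sum_eq_zero fun j _ => integral_fderiv_qmul (hgc j) (qunit_zero j)

theorem continuous_norm_add_S3 (a : Euc 4) : Continuous fun x : S3 => ‖(x : Euc 4) + a‖ := by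
  fun_prop

theorem contDiffAt_inv_sqrt_pow {q : ℝ} (hq : 0 < q) (p : ℕ) :
    ContDiffAt ℝ 1 (fun q => (√q)⁻¹ ^ p) q :=
  ((Real.contDiffAt_sqrt hq.ne').inv (Real.sqrt_pos.mpr hq).ne').pow p

theorem hasDerivAt_inv_sqrt_pow {q : ℝ} (hq : 0 < q) (p : ℕ) :
    HasDerivAt (fun q => (√q)⁻¹ ^ p) (-(p / 2) * (√q)⁻¹ ^ (p + 2)) q := by
  have hs := (Real.sqrt_pos.mpr hq).ne'
  have h := ((Real.hasDerivAt_sqrt hq.ne').inv hs).pow p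
  refine h.congr_deriv ?_
  rcases p with _ | p
  · simp
  · simp only [Pi.inv_apply, Nat.add_sub_cancel]
    rw [show p + 1 + 2 = p + 3 by ring, pow_add _ p 3]
    field_simp

theorem integrable_inv_pow {a : Euc 4} (ha : ‖a‖ < 1) (p : ℕ) :
    Integrable (fun x : S3 => ‖(x : Euc 4) + a‖⁻¹ ^ p) volS3 :=
  integrable_S3 (((continuous_norm_add_S3 a).inv₀ fun x =>
    norm_ne_zero_iff.mpr (add_ne_zero_of_norm_lt ha x)).pow p)

/-- The zonal identity with `F(q) = q^(-1/2)`, everything written in `m = ‖x + a‖`. The constant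
comes from `5/4 · m ≤ 5/2`, as `m ≤ 2`. -/
theorem integral_inv_le {a : Euc 4} (ha : ‖a‖ < 1) :
    ∫ x : S3, ‖(x : Euc 4) + a‖⁻¹ ^ 1 ∂volS3 ≤ 5 / 2 * volS3.real univ := by
  have h := integral_zonal ha (fun q hq => contDiffAt_inv_sqrt_pow hq 1)
    (fun q hq => hasDerivAt_inv_sqrt_pow hq 1)
  have hle : ∀ x : S3, ‖(x : Euc 4) + a‖⁻¹ ^ 1 - 5 / 2 ≤
      2 * (-((1 : ℕ) / 2) * (√(‖(x : Euc 4) + a‖ ^ 2))⁻¹ ^ (1 + 2)) *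
        (‖a‖ ^ 2 - inner ℝ a (x : Euc 4) ^ 2)
      - 3 * (√(‖(x : Euc 4) + a‖ ^ 2))⁻¹ ^ 1 * inner ℝ a (x : Euc 4) := by
    intro x
    have hz := norm_add_sq_S3 a x
    have hm := norm_pos_iff.mpr (add_ne_zero_of_norm_lt ha x)
    have hm2 : ‖(x : Euc 4) + a‖ ≤ 2 := by
      refine (norm_add_le _ _).trans ?_
      rw [norm_S3]
      linarith
    rw [Real.sqrt_sq hm.le]
    generalize ‖(x : Euc 4) + a‖ = m at *
    generalize ‖a‖ = s at *
    have hz' : inner ℝ a (x : Euc 4) = (m ^ 2 - 1 - s ^ 2) / 2 := by linarith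
    rw [hz']
    have key : 2 * (-((1 : ℕ) / 2) * m⁻¹ ^ (1 + 2)) * (s ^ 2 - ((m ^ 2 - 1 - s ^ 2) / 2) ^ 2)
        - 3 * m⁻¹ ^ 1 * ((m ^ 2 - 1 - s ^ 2) / 2) - (m⁻¹ ^ 1 - 5 / 2) =
        (1 - s ^ 2) ^ 2 / 4 * m⁻¹ ^ 3 + 5 / 4 * (2 - m) + s ^ 2 * m⁻¹ := by
      push_cast
      field_simp
      ring
    have : 0 ≤ (1 - s ^ 2) ^ 2 / 4 * m⁻¹ ^ 3 + 5 / 4 * (2 - m) + s ^ 2 * m⁻¹ := by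
      have : 0 ≤ 2 - m := by linarith
      positivity
    linarith
  have hi := integrable_inv_pow ha 1
  have hc : Continuous fun x : S3 =>
      2 * (-((1 : ℕ) / 2) * (√(‖(x : Euc 4) + a‖ ^ 2))⁻¹ ^ (1 + 2)) *
        (‖a‖ ^ 2 - inner ℝ a (x : Euc 4) ^ 2)
      - 3 * (√(‖(x : Euc 4) + a‖ ^ 2))⁻¹ ^ 1 * inner ℝ a (x : Euc 4) := by
    have h1 : Continuous fun x : S3 => (√(‖(x : Euc 4) + a‖ ^ 2))⁻¹ := by
      simp only [Real.sqrt_sq (norm_nonneg _)]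
      exact (continuous_norm_add_S3 a).inv₀ fun x =>
        norm_ne_zero_iff.mpr (add_ne_zero_of_norm_lt ha x)
    fun_prop
  have := integral_mono (hi.sub (integrable_const (5 / 2))) (integrable_S3 hc) hle
  rw [h] at this
  simp only [Pi.sub_apply] at this
  rw [integral_sub hi (integrable_const _), integral_const, smul_eq_mul] at this
  linarith

/-- For `F(q) = q^(-3/2)` the zonal integrand is exactly `3/4` of the difference of the two
integrands. -/
theorem integral_inv_pow_five {a : Euc 4} (ha : ‖a‖ < 1) :
    (1 - ‖a‖ ^ 2) ^ 2 * ∫ x : S3, ‖(x : Euc 4) + a‖⁻¹ ^ 5 ∂volS3 =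
      ∫ x : S3, ‖(x : Euc 4) + a‖⁻¹ ^ 1 ∂volS3 := by
  have h := integral_zonal ha (fun q hq => contDiffAt_inv_sqrt_pow hq 3)
    (fun q hq => hasDerivAt_inv_sqrt_pow hq 3)
  have he : ∀ x : S3, 2 * (-((3 : ℕ) / 2) * (√(‖(x : Euc 4) + a‖ ^ 2))⁻¹ ^ (3 + 2)) *
        (‖a‖ ^ 2 - inner ℝ a (x : Euc 4) ^ 2)
      - 3 * (√(‖(x : Euc 4) + a‖ ^ 2))⁻¹ ^ 3 * inner ℝ a (x : Euc 4) =
      3 / 4 * ((1 - ‖a‖ ^ 2) ^ 2 * ‖(x : Euc 4) + a‖⁻¹ ^ 5 - ‖(x : Euc 4) + a‖⁻¹ ^ 1) := by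
    intro x
    have hz := norm_add_sq_S3 a x
    have hm := norm_pos_iff.mpr (add_ne_zero_of_norm_lt ha x)
    rw [Real.sqrt_sq hm.le]
    generalize ‖(x : Euc 4) + a‖ = m at *
    generalize ‖a‖ = s at *
    have hz' : inner ℝ a (x : Euc 4) = (m ^ 2 - 1 - s ^ 2) / 2 := by linarith
    rw [hz']
    push_cast
    field_simp
    ring
  simp only [he] at h
  rw [integral_const_mul, integral_sub ((integrable_inv_pow ha 5).const_mul _)
    (integrable_inv_pow ha 1), integral_const_mul] at h
  linarith

/-- The `L²` norm of the conformal factor `(1 - |a|²) / |x + a|²` vanishes at the boundary. -/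
theorem integral_conformal_factor_sq_le {a : Euc 4} (ha : ‖a‖ ≤ 1) :
    ∫ x : S3, ((1 - ‖a‖ ^ 2) * ‖(x : Euc 4) + a‖⁻¹ ^ 2) ^ 2 ∂volS3 ≤
      (5 / 2 * √(√(1 - ‖a‖ ^ 2)) + (1 - ‖a‖ ^ 2)) * volS3.real univ := by
  rcases ha.eq_or_lt with h1 | h1
  · simp [h1]
  set ε := 1 - ‖a‖ ^ 2 with hε
  have hε0 : 0 < ε := by
    have := norm_nonneg a
    nlinarith
  -- Split at `m = ε^(1/4)`: below, `m⁻⁴ ≤ η m⁻⁵`, whose integral is controlled; above, `ε² m⁻⁴ ≤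
  -- ε`.
  set η := √(√ε) with hη
  have hη0 : 0 < η := by positivity
  have hη4 : η ^ 4 = ε := by
    rw [show η ^ 4 = (η ^ 2) ^ 2 by ring, Real.sq_sqrt (Real.sqrt_nonneg _), Real.sq_sqrt hε0.le]
  have hle : ∀ x : S3, (ε * ‖(x : Euc 4) + a‖⁻¹ ^ 2) ^ 2 ≤
      ε ^ 2 * η * ‖(x : Euc 4) + a‖⁻¹ ^ 5 + ε := by
    intro x
    have hm := norm_pos_iff.mpr (add_ne_zero_of_norm_lt h1 x)
    generalize ‖(x : Euc 4) + a‖ = m at *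
    rcases le_total m η with h | h
    · have : (ε * m⁻¹ ^ 2) ^ 2 = ε ^ 2 * m * m⁻¹ ^ 5 := by field_simp
      rw [this]
      have : ε ^ 2 * m * m⁻¹ ^ 5 ≤ ε ^ 2 * η * m⁻¹ ^ 5 := by gcongr
      linarith
    · have h2 : (ε * m⁻¹ ^ 2) ^ 2 ≤ ε := by
        have h3 : ε ≤ m ^ 4 := by rw [← hη4]; gcongr
        have : (ε * m⁻¹ ^ 2) ^ 2 = ε * (ε / m ^ 4) := by field_simp
        rw [this]
        exact mul_le_of_le_one_right hε0.le ((div_le_one (by positivity)).mpr h3)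
      have : 0 ≤ ε ^ 2 * η * m⁻¹ ^ 5 := by positivity
      linarith
  have hi := (integrable_inv_pow h1 5).const_mul (ε ^ 2 * η)
  have hc : Continuous fun x : S3 => (ε * ‖(x : Euc 4) + a‖⁻¹ ^ 2) ^ 2 :=
    (continuous_const.mul (((continuous_norm_add_S3 a).inv₀ fun x =>
      norm_ne_zero_iff.mpr (add_ne_zero_of_norm_lt h1 x)).pow 2)).pow 2
  refine (integral_mono (integrable_S3 hc) (hi.add (integrable_const ε)) hle).trans ?_
  simp only [Pi.add_apply]
  rw [integral_add hi (integrable_const _), integral_const_mul, integral_const, smul_eq_mul,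
    mul_comm (ε ^ 2), mul_assoc, integral_inv_pow_five h1]
  have := mul_le_mul_of_nonneg_left (integral_inv_le h1) hη0.le
  linarith

/-! ### The conformal family and its continuity in `W^{1,2}` -/

open scoped Pointwise in
theorem volS3_singleton (x : S3) : volS3 {x} = 0 := by
  rw [volS3, Measure.toSphere_apply' _ (measurableSet_singleton x)]
  have hsub : Ioo (0 : ℝ) 1 • (Subtype.val '' ({x} : Set S3)) ⊆
      (Submodule.span ℝ {(x : Euc 4)} : Set (Euc 4)) := by
    rintro _ ⟨r, -, _, ⟨y, rfl, rfl⟩, rfl⟩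
    exact Submodule.smul_mem _ _ (Submodule.mem_span_singleton_self _)
  have hne : Submodule.span ℝ {(x : Euc 4)} ≠ ⊤ := by
    intro h
    have h1 := finrank_span_le_card (R := ℝ) ({(x : Euc 4)} : Set (Euc 4))
    rw [h, finrank_top] at h1
    simp at h1
  rw [measure_mono_null hsub (Measure.addHaar_submodule _ _ hne), mul_zero]

/-- The inversion in the unit sphere. -/
def inversion4 (y : Euc 4) : Euc 4 := (‖y‖ ^ 2)⁻¹ • y

/-- The derivative of the inversion. -/
def inversion4Deriv (y : Euc 4) : Euc 4 →L[ℝ] Euc 4 :=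
  (‖y‖ ^ 2)⁻¹ • ContinuousLinearMap.id ℝ (Euc 4)
    - (2 * ((‖y‖ ^ 2)⁻¹) ^ 2) • (innerSL ℝ y).smulRight y

theorem hasFDerivAt_inversion4 {y : Euc 4} (hy : y ≠ 0) :
    HasFDerivAt inversion4 (inversion4Deriv y) y := by
  have hn : ‖y‖ ^ 2 ≠ 0 := pow_ne_zero _ (norm_ne_zero_iff.mpr hy)
  have h1 : HasFDerivAt (fun y : Euc 4 => ‖y‖ ^ 2) ((2 : ℝ) • innerSL ℝ y) y := by
    simpa [two_smul] using (hasStrictFDerivAt_norm_sq y).hasFDerivAt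
  have h2 := (hasDerivAt_inv hn).comp_hasFDerivAt y h1
  have h3 := h2.smul (hasFDerivAt_id y)
  refine h3.congr_fderiv ?_
  ext1 v
  simp [inversion4Deriv]
  rw [sub_eq_add_neg, ← neg_smul]
  rw [smul_smul]
  congr 2
  field_simp
  exact neg_smul _ _

theorem norm_inversion4Deriv_le (y : Euc 4) : ‖inversion4Deriv y‖ ≤ 3 * ‖y‖⁻¹ ^ 2 := by
  refine (norm_sub_le _ _).trans ?_
  rw [norm_smul, norm_smul, ContinuousLinearMap.norm_smulRight_apply, innerSL_apply_norm]
  rcases eq_or_ne y 0 with rfl | hy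
  · simp
  · have hn := norm_pos_iff.mpr hy
    have h1 : ‖ContinuousLinearMap.id ℝ (Euc 4)‖ ≤ 1 := ContinuousLinearMap.norm_id_le
    rw [Real.norm_of_nonneg (by positivity), Real.norm_of_nonneg (by positivity)]
    calc _ ≤ (‖y‖ ^ 2)⁻¹ * 1 + 2 * ((‖y‖ ^ 2)⁻¹) ^ 2 * (‖y‖ * ‖y‖) := by gcongr
      _ = _ := by field_simp; ring

theorem continuousAt_inversion4Deriv {y : Euc 4} (hy : y ≠ 0) :
    ContinuousAt inversion4Deriv y := by
  have hn : ‖y‖ ^ 2 ≠ 0 := pow_ne_zero _ (norm_ne_zero_iff.mpr hy)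
  have h1 : ContinuousAt (fun y : Euc 4 => (‖y‖ ^ 2)⁻¹) y :=
    (continuousAt_id.norm.pow 2).inv₀ hn
  have h2 : Continuous fun y : Euc 4 => (innerSL ℝ y).smulRight y := by fun_prop
  exact (h1.smul continuousAt_const).sub ((continuousAt_const.mul (h1.pow 2)).smul h2.continuousAt)

/-- The conformal diffeomorphism of `S³` with parameter `a`, `|a| < 1`; it is the constant `a` for
`|a| = 1`. -/
def moebius (a x : Euc 4) : Euc 4 := a + (1 - ‖a‖ ^ 2) • inversion4 (x + a)

/-- For `|a| < 1`, inversion sends the unit sphere about `a` to the sphere of radius `1 / (1 -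
|a|²)` about `-a / (1 - |a|²)`; scaling and translating restore the unit sphere. -/
theorem norm_moebius {a : Euc 4} (ha : ‖a‖ ≤ 1) (x : S3) : ‖moebius a x‖ = 1 := by
  rcases ha.eq_or_lt with h | h
  · simp [moebius, h]
  · have hm := norm_pos_iff.mpr (add_ne_zero_of_norm_lt h x)
    have hz := norm_add_sq_S3 a x
    have hi : inner ℝ a ((x : Euc 4) + a) = (‖(x : Euc 4) + a‖ ^ 2 - 1 + ‖a‖ ^ 2) / 2 := by
      rw [inner_add_right, real_inner_self_eq_norm_sq]
      linarith
    have hsq : ‖moebius a x‖ ^ 2 = 1 ^ 2 := by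
      rw [moebius, inversion4, smul_smul, norm_add_sq_real, inner_smul_right, norm_smul, hi,
        mul_pow, Real.norm_eq_abs, sq_abs]
      field_simp
      ring
    exact (pow_left_inj₀ (norm_nonneg _) zero_le_one two_ne_zero).mp hsq

/-- For `|a| = 1` the factor `1 - |a|²` makes the map constant, so `x = -a` is harmless there. -/
theorem hasFDerivAt_moebius {a x : Euc 4} (h : ‖a‖ = 1 ∨ x + a ≠ 0) :
    HasFDerivAt (moebius a) ((1 - ‖a‖ ^ 2) • inversion4Deriv (x + a)) x := by
  rcases h with h | h
  · have : moebius a = fun _ => a := by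
      funext y
      simp [moebius, h]
    rw [this, h]
    refine (hasFDerivAt_const a x).congr_fderiv ?_
    ext1 v
    simp
  · have h1 := (hasFDerivAt_inversion4 h).comp x ((hasFDerivAt_id x).add_const a)
    exact (h1.const_smul (1 - ‖a‖ ^ 2)).const_add a

theorem contDiffAt_inversion4 {y : Euc 4} (hy : y ≠ 0) : ContDiffAt ℝ 1 inversion4 y :=
  ((contDiff_norm_sq ℝ).contDiffAt.inv (pow_ne_zero _ (norm_ne_zero_iff.mpr hy))).smul contDiffAt_id

theorem contDiffAt_moebius {a x : Euc 4} (h : ‖a‖ = 1 ∨ x + a ≠ 0) :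
    ContDiffAt ℝ 1 (moebius a) x := by
  rcases h with h | h
  · have : moebius a = fun _ => a := by
      funext y
      simp [moebius, h]
    rw [this]
    exact contDiffAt_const
  · exact contDiffAt_const.add (((contDiffAt_inversion4 h).comp x
      (contDiffAt_id.add contDiffAt_const)).const_smul _)

theorem norm_ClosedB4 (a : ClosedB4) : ‖(a : Euc 4)‖ ≤ 1 :=
  mem_closedBall_zero_iff.mp a.2

theorem regular_ClosedB4 (a : ClosedB4) (x : S3) :
    ‖(a : Euc 4)‖ = 1 ∨ (x : Euc 4) + a ≠ 0 :=
  (norm_ClosedB4 a).eq_or_lt.imp_right fun h => add_ne_zero_of_norm_lt h x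

/-- The conformal translates of the Hopf map. -/
def hopfMoebius (a x : Euc 4) : Euc 3 := hopf (moebius a x)

theorem contDiffAt_hopfMoebius {a x : Euc 4} (h : ‖a‖ = 1 ∨ x + a ≠ 0) :
    ContDiffAt ℝ 1 (hopfMoebius a) x :=
  (contDiff_hopf.of_le (by exact_mod_cast le_top)).contDiffAt.comp x (contDiffAt_moebius h)

theorem fderiv_hopfMoebius {a x : Euc 4} (h : ‖a‖ = 1 ∨ x + a ≠ 0) :
    fderiv ℝ (hopfMoebius a) x =
      (fderiv ℝ hopf (moebius a x)).comp ((1 - ‖a‖ ^ 2) • inversion4Deriv (x + a)) :=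
  ((contDiff_hopf.differentiable (by norm_num) _).hasFDerivAt.comp x
    (hasFDerivAt_moebius h)).fderiv

theorem norm_hopfMoebius (a : ClosedB4) (x : S3) : ‖hopfMoebius a x‖ = 1 := by
  rw [hopfMoebius, norm_hopf, norm_moebius (norm_ClosedB4 a), one_pow]

/-- The tangential differential of `hopfMoebius`. -/
def hopfMoebiusDiff (a : Euc 4) (x : S3) : Euc 4 →L[ℝ] Euc 3 :=
  (fderiv ℝ (hopfMoebius a) x).comp
    (ContinuousLinearMap.id ℝ (Euc 4) - (innerSL ℝ (x : Euc 4)).smulRight (x : Euc 4))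

theorem continuous_hopfMoebius (a : ClosedB4) : Continuous fun x : S3 => hopfMoebius a x :=
  continuous_comp_S3 fun x => contDiffAt_hopfMoebius (regular_ClosedB4 a x)

theorem continuous_hopfMoebiusDiff (a : ClosedB4) : Continuous (hopfMoebiusDiff a) := by
  have h1 := continuous_fderiv_S3 fun x => contDiffAt_hopfMoebius (regular_ClosedB4 a x)
  have h2 : Continuous fun x : S3 => ContinuousLinearMap.id ℝ (Euc 4) -
      (innerSL ℝ (x : Euc 4)).smulRight (x : Euc 4) := by fun_prop
  exact h1.clm_comp h2

/-- Chain rule: `C` bounds the differential of `hopf` on the sphere, `3` comes from the inversion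
and `2` from the tangential projection. -/
theorem exists_norm_hopfMoebiusDiff_le : ∃ C, 0 ≤ C ∧ ∀ (a : ClosedB4) (x : S3),
    ‖hopfMoebiusDiff a x‖ ≤ C * ((1 - ‖(a : Euc 4)‖ ^ 2) * ‖(x : Euc 4) + a‖⁻¹ ^ 2) := by
  obtain ⟨C, hC⟩ := exists_bound_S3 (continuous_fderiv_S3 fun x =>
    (contDiff_hopf.of_le (by exact_mod_cast le_top)).contDiffAt)
  have hC0 : 0 ≤ C := (norm_nonneg _).trans (hC (qunit 0))
  refine ⟨C * 3 * 2, by positivity, fun a x => ?_⟩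
  have hε : 0 ≤ 1 - ‖(a : Euc 4)‖ ^ 2 :=
    sub_nonneg.mpr (pow_le_one₀ (norm_nonneg _) (norm_ClosedB4 a))
  have hP : ‖ContinuousLinearMap.id ℝ (Euc 4) -
      (innerSL ℝ (x : Euc 4)).smulRight (x : Euc 4)‖ ≤ 2 := by
    refine (norm_sub_le _ _).trans ?_
    rw [ContinuousLinearMap.norm_smulRight_apply, innerSL_apply_norm, norm_S3]
    have : ‖ContinuousLinearMap.id ℝ (Euc 4)‖ ≤ 1 := ContinuousLinearMap.norm_id_le
    linarith
  rw [hopfMoebiusDiff, fderiv_hopfMoebius (regular_ClosedB4 a x)]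
  calc _ ≤ ‖fderiv ℝ hopf (moebius a x)‖ *
        ‖(1 - ‖(a : Euc 4)‖ ^ 2) • inversion4Deriv ((x : Euc 4) + a)‖ * 2 := by
        refine (ContinuousLinearMap.opNorm_comp_le _ _).trans ?_
        gcongr
        exact ContinuousLinearMap.opNorm_comp_le _ _
    _ ≤ C * ((1 - ‖(a : Euc 4)‖ ^ 2) * (3 * ‖(x : Euc 4) + a‖⁻¹ ^ 2)) * 2 := by
        rw [norm_smul, Real.norm_of_nonneg hε]
        gcongr
        · exact hC ⟨moebius a x, by simp [norm_moebius (norm_ClosedB4 a)]⟩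
        · exact norm_inversion4Deriv_le _
    _ = _ := by ring

theorem continuousAt_moebius {a x : Euc 4} (h : x + a ≠ 0) :
    ContinuousAt (fun p : Euc 4 × Euc 4 => moebius p.1 p.2) (a, x) := by
  have h1 : ContinuousAt (fun p : Euc 4 × Euc 4 => inversion4 (p.2 + p.1)) (a, x) :=
    ContinuousAt.comp (g := inversion4) (f := fun p : Euc 4 × Euc 4 => p.2 + p.1)
      (contDiffAt_inversion4 h).continuousAt (by fun_prop)
  exact continuousAt_fst.add ((continuousAt_const.sub (continuousAt_fst.norm.pow 2)).smul h1)

theorem tendsto_hopfMoebius (b : ClosedB4) {x : S3} (h : (x : Euc 4) + b ≠ 0) :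
    ContinuousAt (fun a : ClosedB4 => hopfMoebius a x) b := by
  refine contDiff_hopf.continuous.continuousAt.comp ?_
  exact ContinuousAt.comp (g := fun p : Euc 4 × Euc 4 => moebius p.1 p.2)
    (f := fun a : ClosedB4 => ((a : Euc 4), (x : Euc 4))) (continuousAt_moebius h) (by fun_prop)

theorem tendsto_hopfMoebiusDiff (b : ClosedB4) {x : S3} (h : (x : Euc 4) + b ≠ 0) :
    ContinuousAt (fun a : ClosedB4 => hopfMoebiusDiff a x) b := by
  have he : (fun a : ClosedB4 => hopfMoebiusDiff a x) = fun a : ClosedB4 =>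
      ((fderiv ℝ hopf (moebius a x)).comp
        ((1 - ‖(a : Euc 4)‖ ^ 2) • inversion4Deriv ((x : Euc 4) + a))).comp
      (ContinuousLinearMap.id ℝ (Euc 4) - (innerSL ℝ (x : Euc 4)).smulRight (x : Euc 4)) := by
    funext a
    rw [hopfMoebiusDiff, fderiv_hopfMoebius (regular_ClosedB4 a x)]
  rw [he]
  have h1 : ContinuousAt (fun a : ClosedB4 => fderiv ℝ hopf (moebius a x)) b := by
    refine (contDiff_hopf.continuous_fderiv (by norm_num)).continuousAt.comp ?_
    exact ContinuousAt.comp (g := fun p : Euc 4 × Euc 4 => moebius p.1 p.2)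
      (f := fun a : ClosedB4 => ((a : Euc 4), (x : Euc 4))) (continuousAt_moebius h) (by fun_prop)
  have h2 : ContinuousAt (fun a : ClosedB4 => inversion4Deriv ((x : Euc 4) + a)) b :=
    ContinuousAt.comp (g := inversion4Deriv) (f := fun a : ClosedB4 => (x : Euc 4) + a)
      (continuousAt_inversion4Deriv h) (by fun_prop)
  have h3 : ContinuousAt (fun a : ClosedB4 => 1 - ‖(a : Euc 4)‖ ^ 2) b := by fun_prop
  exact (h1.clm_comp (h3.smul h2)).clm_comp continuousAt_const

theorem ae_add_ne_zero (b : ClosedB4) : ∀ᵐ x : S3 ∂volS3, (x : Euc 4) + b ≠ 0 := by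
  rcases (norm_ClosedB4 b).eq_or_lt with h | h
  · let y : S3 := ⟨-b, by simp [h]⟩
    have : ∀ᵐ x : S3 ∂volS3, x ∉ ({y} : Set S3) :=
      measure_eq_zero_iff_ae_notMem.mp (volS3_singleton y)
    filter_upwards [this] with x hx h0
    exact hx (Subtype.ext (eq_neg_of_add_eq_zero_left h0))
  · exact Filter.Eventually.of_forall fun x => add_ne_zero_of_norm_lt h x

theorem norm_toLp_S3_sq {F : Type*} [NormedAddCommGroup F] {f : S3 → F} (hf : MemLp f 2 volS3) :
    ‖hf.toLp f‖ ^ 2 = ∫ x, ‖f x‖ ^ 2 ∂volS3 := by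
  have h : ‖hf.toLp f‖ = ‖hf.norm.toLp _‖ := by
    rw [Lp.norm_toLp, Lp.norm_toLp, eLpNorm_norm]
  rw [h, norm_toLp_eq_sqrt_integral, Real.sq_sqrt (integral_nonneg fun x => sq_nonneg _)]

/-- Bounded pointwise convergence implies convergence in `L²(S³)`. -/
theorem continuousAt_toLp_of_bounded {α F : Type*} [TopologicalSpace α] [FirstCountableTopology α]
    [NormedAddCommGroup F] {f : α → S3 → F} (hf : ∀ a, Continuous (f a)) {b : α} {C : ℝ}
    (hC : ∀ᶠ a in nhds b, ∀ x, ‖f a x‖ ≤ C)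
    (hlim : ∀ᵐ x ∂volS3, ContinuousAt (fun a => f a x) b) :
    ContinuousAt (fun a => (memLp_S3 (hf a)).toLp (f a)) b := by
  have h0 : Filter.Tendsto (fun a => ∫ x, ‖f a x - f b x‖ ^ 2 ∂volS3) (nhds b)
      (nhds (∫ _, (0 : ℝ) ∂volS3)) := by
    refine tendsto_integral_filter_of_dominated_convergence (fun _ => (C + C) ^ 2) ?_ ?_
      (integrable_const _) ?_
    · exact Filter.Eventually.of_forall fun a =>
        (((hf a).sub (hf b)).norm.pow 2).aestronglyMeasurable_of_compactSpace
    · filter_upwards [hC] with a ha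
      refine Filter.Eventually.of_forall fun x => ?_
      rw [Real.norm_of_nonneg (sq_nonneg _)]
      gcongr
      exact (norm_sub_le _ _).trans (add_le_add (ha x) (hC.self_of_nhds x))
    · filter_upwards [hlim] with x hx
      have : ContinuousAt (fun a => ‖f a x - f b x‖ ^ 2) b := (hx.sub continuousAt_const).norm.pow 2
      simpa [ContinuousAt] using this
  rw [integral_zero] at h0
  rw [ContinuousAt, tendsto_iff_norm_sub_tendsto_zero]
  have h1 := h0.sqrt
  rw [Real.sqrt_zero] at h1
  refine h1.congr fun a => ?_
  rw [← MemLp.toLp_sub, Real.sqrt_eq_iff_mul_self_eq (integral_nonneg fun x => sq_nonneg _)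
    (norm_nonneg _), ← sq, norm_toLp_S3_sq]
  rfl

theorem IsWeakDifferential.congr {u u' : S3 → Euc 3} {G G' : S3 → (Euc 4 →L[ℝ] Euc 3)}
    (h : IsWeakDifferential u G) (hu : u =ᵐ[volS3] u') (hG : G =ᵐ[volS3] G') :
    IsWeakDifferential u' G' := by
  refine ⟨?_, fun X hX hXt => ?_⟩
  · filter_upwards [h.1, hG] with x h1 h2
    rw [← h2, h1]
  · have h1 : ∫ x, divS3 X x • u' x ∂volS3 = ∫ x, divS3 X x • u x ∂volS3 := by
      refine integral_congr_ae ?_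
      filter_upwards [hu] with x hx
      rw [hx]
    have h2 : ∫ x : S3, G' x (X x) ∂volS3 = ∫ x : S3, G x (X x) ∂volS3 := by
      refine integral_congr_ae ?_
      filter_upwards [hG] with x hx
      rw [hx]
    rw [h1, h2, h.2 X hX hXt]

/-- The conformal translates of the Hopf map, as Sobolev maps. -/
def hopfFamily (a : ClosedB4) : W12 :=
  ⟨((memLp_S3 (continuous_hopfMoebius a)).toLp _,
    (memLp_S3 (continuous_hopfMoebiusDiff a)).toLp _), by
    refine ⟨(isWeakDifferential_of_contDiffAt fun x =>
      contDiffAt_hopfMoebius (regular_ClosedB4 a x)).congr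
      (memLp_S3 (continuous_hopfMoebius a)).coeFn_toLp.symm
      (memLp_S3 (continuous_hopfMoebiusDiff a)).coeFn_toLp.symm, ?_⟩
    filter_upwards [(memLp_S3 (continuous_hopfMoebius a)).coeFn_toLp] with x hx
    rw [hx, mem_sphere_zero_iff_norm, norm_hopfMoebius]⟩

theorem hopfFamily_map (a : ClosedB4) :
    (hopfFamily a).map =ᵐ[volS3] fun x : S3 => hopfMoebius a x :=
  (memLp_S3 (continuous_hopfMoebius a)).coeFn_toLp

/-- The maps have norm one and converge off at most one point. The differentials converge boundedly
near an interior parameter; at the boundary their limit is zero and the `L²` bound on the conformal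
factor replaces domination. -/
theorem continuous_hopfFamily : Continuous hopfFamily := by
  refine Continuous.subtype_mk (Continuous.prodMk ?_ ?_) _
  · refine continuous_iff_continuousAt.mpr fun b => ?_
    refine continuousAt_toLp_of_bounded (C := 1) continuous_hopfMoebius
      (Filter.Eventually.of_forall fun a x => (norm_hopfMoebius a x).le) ?_
    filter_upwards [ae_add_ne_zero b] with x hx
    exact tendsto_hopfMoebius b hx
  · obtain ⟨C, hC0, hC⟩ := exists_norm_hopfMoebiusDiff_le
    have hε : ∀ a : ClosedB4, 0 ≤ 1 - ‖(a : Euc 4)‖ ^ 2 := fun a =>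
      sub_nonneg.mpr (pow_le_one₀ (norm_nonneg _) (norm_ClosedB4 a))
    refine continuous_iff_continuousAt.mpr fun b => ?_
    rcases (norm_ClosedB4 b).eq_or_lt with h | h
    · have hb : ((memLp_S3 (continuous_hopfMoebiusDiff b)).toLp _) = 0 := by
        rw [← norm_eq_zero, ← pow_eq_zero_iff two_ne_zero, norm_toLp_S3_sq]
        have : ∀ x, hopfMoebiusDiff b x = 0 := fun x => by
          rw [← norm_le_zero_iff]
          refine (hC b x).trans ?_
          rw [h]
          norm_num
        simp [this]
      rw [ContinuousAt, hb, tendsto_zero_iff_norm_tendsto_zero]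
      let B : ClosedB4 → ℝ := fun a => C ^ 2 * ((5 / 2 * √(√(1 - ‖(a : Euc 4)‖ ^ 2))
        + (1 - ‖(a : Euc 4)‖ ^ 2)) * volS3.real univ)
      have hB : ContinuousAt (fun a => √(B a)) b := by fun_prop
      have hB0 : √(B b) = 0 := by simp [B, h]
      rw [ContinuousAt, hB0] at hB
      refine squeeze_zero (fun _ => norm_nonneg _) (fun a => ?_) hB
      refine Real.le_sqrt_of_sq_le ?_
      rw [norm_toLp_S3_sq]
      refine le_trans ?_ (mul_le_mul_of_nonneg_left
        (integral_conformal_factor_sq_le (norm_ClosedB4 a)) (sq_nonneg C))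
      rw [← integral_const_mul]
      have hint : Integrable (fun x : S3 => C ^ 2 *
          ((1 - ‖(a : Euc 4)‖ ^ 2) * ‖(x : Euc 4) + a‖⁻¹ ^ 2) ^ 2) volS3 := by
        rcases (norm_ClosedB4 a).eq_or_lt with h | h
        · simp [h]
        · exact integrable_S3 (continuous_const.mul ((continuous_const.mul
            (((continuous_norm_add_S3 a).inv₀ fun x =>
              norm_ne_zero_iff.mpr (add_ne_zero_of_norm_lt h x)).pow 2)).pow 2))
      refine integral_mono (memLp_S3 (continuous_hopfMoebiusDiff a)).norm.integrable_sq hint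
        fun x => ?_
      rw [← mul_pow]
      exact pow_le_pow_left₀ (norm_nonneg _) (hC a x) 2
    -- Parameters of norm below the midpoint `r` of `‖b‖` and `1` keep `‖x + a‖ ≥ 1 - r`, a uniform
    -- bound.
    · set r := (1 + ‖(b : Euc 4)‖) / 2 with hr
      have hr1 : r < 1 := by linarith
      have hbr : ‖(b : Euc 4)‖ < r := by linarith
      refine continuousAt_toLp_of_bounded (C := C * (1 * (1 - r)⁻¹ ^ 2))
        continuous_hopfMoebiusDiff ?_ (Filter.Eventually.of_forall fun x =>
          tendsto_hopfMoebiusDiff b (add_ne_zero_of_norm_lt h x))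
      have hcn : Continuous fun a : ClosedB4 => ‖(a : Euc 4)‖ := by fun_prop
      filter_upwards [hcn.continuousAt.eventually_lt_const hbr] with a ha x
      refine (hC a x).trans ?_
      have h1 : 1 - r ≤ ‖(x : Euc 4) + a‖ := by
        have := norm_sub_norm_le (x : Euc 4) (-(a : Euc 4))
        rw [norm_S3, norm_neg, sub_neg_eq_add] at this
        linarith
      have h2 : 0 < 1 - r := by linarith
      have h3 : 1 - ‖(a : Euc 4)‖ ^ 2 ≤ 1 := by
        have := sq_nonneg ‖(a : Euc 4)‖
        linarith
      gcongr

/-- The conformal translates of the Hopf map form a sweepout. -/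
theorem sweep11_nonempty : Sweep11.Nonempty := by
  refine ⟨⟨hopfFamily, continuous_hopfFamily⟩, ?_, hopfMap, fun a => ?_, not_nullhomotopic_hopfMap⟩
  · have hmem : ∀ p : OpenB4 × S3, hopfMoebius p.1 p.2 ∈ sphere (0 : Euc 3) 1 := fun p => by
      rw [mem_sphere_zero_iff_norm]
      exact norm_hopfMoebius p.1.incl p.2
    have hc : Continuous fun p : OpenB4 × S3 => hopfMoebius p.1 p.2 := by
      refine contDiff_hopf.continuous.comp (continuous_iff_continuousAt.mpr fun p => ?_)
      have hp : ‖(p.1 : Euc 4)‖ < 1 := mem_ball_zero_iff.mp p.1.2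
      exact ContinuousAt.comp (g := fun p : Euc 4 × Euc 4 => moebius p.1 p.2)
        (f := fun p : OpenB4 × S3 => ((p.1 : Euc 4), (p.2 : Euc 4)))
        (continuousAt_moebius (add_ne_zero_of_norm_lt hp p.2)) (by fun_prop)
    exact ⟨⟨_, hc.subtype_mk hmem⟩, fun a => hopfFamily_map a.incl⟩
  · filter_upwards [hopfFamily_map (boundaryIncl a)] with x hx
    refine hx.trans ?_
    change hopf (moebius a x) = hopf a
    simp [moebius]

end

theorem mainTheorem9 :
    Sweep11.Nonempty ∧
    (∀ u ∈ Sweep11, ∃ a₀ : ClosedB4, ∀ a : ClosedB4,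
      dirichletEnergy (u a) ≤ dirichletEnergy (u a₀)) ∧
    0 < width11 := by
  exact ⟨sweep11_nonempty, fun u _ => exists_max_dirichletEnergy u, width11_pos sweep11_nonempty⟩
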